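/- **Supermodular paging.** Let $\mathcal P$ be a finite non-empty set of pages, $f:2^{\mathcal P}\to\mathbb N$ a monotone set function that is supermodular, i.e. $f(S)+f(S')\le f(S\cup S')+f(S\cap S')$ for all $S,S'\subseteq\mathcal P$ (equivalently, the cover function $g(S)=f(\mathcal P)-f(\mathcal P\setminus S)$ is submodular), $k\in\mathbb N$ a cache threshold and $c:\mathcal P\to(0,\infty)$ the eviction costs. A set $S\subseteq\mathcal P$ is feasible if $f(S)\le k$, and every single page is assumed to be feasible. The cache is initially empty. Requests $p_1,p_2,\dots,p_T\in\mathcal P$ arrive one by one; at time $t$ the page $p_t$ is fetched if it is not in the cache, and possibly some pages are evicted, so that the new cache $S_t\subseteq S_{t-1}\cup\{p_t\}$ contains $p_t$ and is feasible. The cost is the total eviction cost $\sum_{t=1}^{T}\sum_{p\in S_{t-1}\setminus S_t}c(p)$, and $\mathrm{OPT}(\sigma)$ is the minimum cost of serving the request sequence $\sigma=(p_1,\dots,p_T)$ offline. An online algorithm chooses $S_t$ knowing only $p_1,\dots,p_t$ (and the instance $\mathcal P,f,k,c$); a randomized online algorithm is a random variable whose values are deterministic online algorithms. **Theorem 1.6.**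 Let $\mu=\max\{|S| : S\subseteq\mathcal P,\ f(S)\le k\}$, $c_{\max}=\max_{p}c(p)$ and $c_{\min}=\min_p c(p)$. For supermodular paging there is an $O\!\left(\log^2\mu\cdot\log\!\left(\frac{c_{\max}}{c_{\min}}\cdot f(\mathcal P)\right)\right)$-competitive randomized online algorithm, where in the $O$-notation each argument $x$ of a logarithm is read as $1+x$, so that the factors do not vanish when $\mu=1$ or $\frac{c_{\max}}{c_{\min}}f(\mathcal P)=1$. That is, there is an absolute constant $K>0$ such that for every instance of supermodular paging there is a randomized online algorithm whose expected cost on every request sequence $\sigma$ is at most $$K\cdot\log^2(1+\mu)\cdot\log\!\left(1+\frac{c_{\max}}{c_{\min}}\cdot f(\mathcal P)\right)\cdot\mathrm{OPT}(\sigma).$$ -/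

import Mathlib

open MeasureTheory

universe u

/-- A set function `f : 2^P → ℕ` is supermodular if
`f S + f S' ≤ f (S ∪ S') + f (S ∩ S')` for all `S`, `S'`. -/
def IsSupermodular {P : Type u} [DecidableEq P] (f : Finset P → ℕ) : Prop :=
  ∀ S S' : Finset P, f S + f S' ≤ f (S ∪ S') + f (S ∩ S')

/-- An instance of non-linear paging over a finite set of pages `P`: a monotone feasibility
function `f`, a cache threshold `k` and strictly positive eviction costs. Every single page fits
in the cache on its own, so that every request can be served. -/
structure PagingInstance (P : Type u) where
  f : Finset P → ℕ
  mono : ∀ S' S : Finset P, S' ⊆ S → f S' ≤ f S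
  k : ℕ
  c : P → ℝ
  c_pos : ∀ p, 0 < c p
  single_le : ∀ p, f {p} ≤ k

namespace PagingInstance

variable {P : Type u} (I : PagingInstance P)

/-- The maximum cardinality of a feasible set of pages. -/
def mu [Fintype P] : ℕ :=
  (Finset.univ.filter (fun S : Finset P => I.f S ≤ I.k)).sup Finset.card

/-- The maximum cost of a page. -/
noncomputable def cmax [Fintype P] [Nonempty P] : ℝ :=
  Finset.univ.sup' Finset.univ_nonempty I.c

/-- The minimum cost of a page. -/
noncomputable def cmin [Fintype P] [Nonempty P] : ℝ :=
  Finset.univ.inf' Finset.univ_nonempty I.c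

/-- `S 0, S 1, …` serves the request sequence `σ`: the cache is initially empty, and `S (i + 1)`,
the cache after serving the request `σ[i]`, contains the requested page, is feasible, and arises
from `S i` by fetching at most the requested page and evicting some pages. -/
def IsSchedule [DecidableEq P] (σ : List P) (S : ℕ → Finset P) : Prop :=
  S 0 = ∅ ∧ ∀ (i : ℕ) (hi : i < σ.length),
    σ[i] ∈ S (i + 1) ∧ S (i + 1) ⊆ insert σ[i] (S i) ∧ I.f (S (i + 1)) ≤ I.k

/-- The total eviction cost of the cache contents `S 0, …, S T`. -/
def cost [DecidableEq P] (T : ℕ) (S : ℕ → Finset P) : ℝ :=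
  ∑ i ∈ Finset.range T, ∑ p ∈ S i \ S (i + 1), I.c p

/-- The offline optimum: the least eviction cost of serving `σ`. -/
noncomputable def opt [DecidableEq P] (σ : List P) : ℝ :=
  sInf {x : ℝ | ∃ S : ℕ → Finset P, I.IsSchedule σ S ∧ x = I.cost σ.length S}

/-- A deterministic online algorithm for the instance: it maps the sequence of the requests that
have been revealed so far to the cache contents after serving the last one of them. -/
structure OnlineAlgorithm [DecidableEq P] where
  cache : List P → Finset P
  serves : ∀ σ : List P, I.IsSchedule σ (fun i => cache (σ.take i))

/-- A randomized online algorithm: a random variable, on some probability space, whose values are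
deterministic online algorithms. -/
structure RandomizedAlgorithm [DecidableEq P] where
  Ω : Type u
  [measurableSpace : MeasurableSpace Ω]
  prob : Measure Ω
  [isProbabilityMeasure : IsProbabilityMeasure prob]
  alg : Ω → I.OnlineAlgorithm
  measurable_cache : ∀ (σ : List P) (S : Finset P), MeasurableSet {ω | (alg ω).cache σ = S}

attribute [instance] RandomizedAlgorithm.measurableSpace
attribute [instance] RandomizedAlgorithm.isProbabilityMeasure

/-- The expected eviction cost of a randomized online algorithm on the request sequence `σ`. -/
noncomputable def expectedCost [DecidableEq P] (A : I.RandomizedAlgorithm) (σ : List P) : ℝ :=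
  ∫ ω, I.cost σ.length (fun i => (A.alg ω).cache (σ.take i)) ∂A.prob

/-- A randomized online algorithm is `ρ`-competitive if on every request sequence its expected
cost is at most `ρ` times the offline optimum. -/
def IsCompetitive [DecidableEq P] (A : I.RandomizedAlgorithm) (ρ : ℝ) : Prop :=
  ∀ σ : List P, I.expectedCost A σ ≤ ρ * I.opt σ

/-- Every request sequence can be served, so `opt` is the infimum of a non-empty set. -/
theorem exists_isSchedule [DecidableEq P] (σ : List P) : ∃ S, I.IsSchedule σ S := by
  refine ⟨fun i => match i with
    | 0 => ∅
    | i + 1 => if h : i < σ.length then {σ[i]} else ∅, rfl, fun i hi => ?_⟩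
  simp [hi, I.single_le]

theorem cost_nonneg [DecidableEq P] (T : ℕ) (S : ℕ → Finset P) : 0 ≤ I.cost T S :=
  Finset.sum_nonneg fun _ _ => Finset.sum_nonneg fun p _ => (I.c_pos p).le

/-- The offline optimum is a lower bound for the cost of every schedule. -/
theorem opt_le_cost [DecidableEq P] {σ : List P} {S : ℕ → Finset P} (h : I.IsSchedule σ S) :
    I.opt σ ≤ I.cost σ.length S :=
  csInf_le ⟨0, by rintro x ⟨S, -, rfl⟩; exact I.cost_nonneg _ _⟩ ⟨S, h, rfl⟩

end PagingInstance

/-! A fractional absence `x p` is maintained for every page and rounded online with thresholds that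
are drawn only once.

Fractional part. By supermodularity the excess max(f - k, 0) has marginals that grow with the set.
Hence, if the pages of `E` are absent from a feasible cache, their marginals at any `S` add up to at
least the excess of `S`; normalised, this is a covering row with coefficients in [0, 1]. Only rows
on light pages (`x p < 1 / 2`) are enforced, and a uniform row keeps the number of light pages at
most 2μ, so all relevant rows have at most 2μ entries (`isCovering_of_satisfiesRows`).
Multiplicative updates repair violated rows (`exists_update_step`), and a logarithmic potential
bounds the total movement by O(log μ) times the cost of any schedule (`raise_le`).

Rounding. Levels are the doubled absences, rounded down to multiples of 1 / (2μ). A page is hit if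
one of its N uniform thresholds lies below its level. Each round halves the expected excess of the
unhit pages (`sum_unhit_le`), so they fail to fit with probability at most f(P) / 2^N, and then the
cache is cut down to level 0. Since thresholds are fixed, rising levels evict at expected cost at
most N times the weighted rise. Failures matter only in steps where some level changes; discreteness
of the levels bounds the number of these steps by μ plus twice the number of unit rises
(`sum_changed_le`), independently of the length of σ. So N = O(log(μ · (c_max / c_min) · f(P)))
rounds make failures negligible, and this N is absorbed into a product of two logarithms. -/

set_option linter.unusedSectionVars false

/-! ### Threshold sampling; sums over all θ are unnormalised expectations. -/

section Sampling

open Finset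

/-- Resampling one coordinate of a uniform θ leaves it uniform: exchanging `θ i` with `v` is an
involution of the pairs `(θ, v)`. -/
theorem sum_sum_update {ι V : Type*} [Fintype ι] [DecidableEq ι] [Fintype V] (i : ι)
    (h : (ι → V) → ℝ) :
    ∑ θ, ∑ v, h (Function.update θ i v) = Fintype.card V * ∑ θ, h θ := by
  let e : (ι → V) × V → (ι → V) × V := fun z => (Function.update z.1 i z.2, z.1 i)
  have he : Function.Involutive e := fun z => by simp [e]
  rw [← Fintype.sum_prod_type' (f := fun θ v => h (Function.update θ i v))]
  have := Equiv.sum_comp he.toPerm (fun z : (ι → V) × V => h z.1)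
  simp only [Function.Involutive.coe_toPerm, e] at this
  rw [this, Fintype.sum_prod_type]
  simp [Finset.mul_sum]

theorem card_mul_sum_apply {ι V : Type*} [Fintype ι] [DecidableEq ι] [Fintype V] (i : ι)
    (g : V → ℝ) :
    Fintype.card V * ∑ θ : ι → V, g (θ i) = Fintype.card (ι → V) * ∑ v, g v := by
  rw [← sum_sum_update i]
  simp [Finset.mul_sum]

variable {P : Type u} [Fintype P] [DecidableEq P]

/-- The marginals `g S - g (S \ {p})` are nonnegative and do not decrease when `S` grows. -/
def MonotoneMarginals (g : Finset P → ℝ) : Prop :=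
  ∀ (p : P) (S' S : Finset P), S' ⊆ S → g S' - g (S'.erase p) ≤ g S - g (S.erase p)

/-- The pages of `s` whose threshold lies below their level `y`. -/
def hitSet {M : ℕ} (y : P → ℕ) (θ : P → Fin M) (s : Finset P) : Finset P :=
  s.filter fun p => (θ p : ℕ) < y p

/-- Expose the pages one at a time. Page `p` is removed with probability `y p / M`, which lowers `g`
by its marginal at that moment; the marginal at the final, smaller set is no larger. -/
theorem sum_hitSet_le {M : ℕ} (hM : 0 < M) {g : Finset P → ℝ} (hg : MonotoneMarginals g)
    (y : P → ℕ) (s : Finset P) (hy : ∀ p ∈ s, y p ≤ M) (S : Finset P) :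
    ∑ θ : P → Fin M, (g (S \ hitSet y θ s) + ∑ p ∈ s, (y p : ℝ) / M *
        (g (S \ hitSet y θ s) - g ((S \ hitSet y θ s).erase p))) ≤
      Fintype.card (P → Fin M) * g S := by
  induction s using Finset.induction_on generalizing S with
  | empty => simp [hitSet]
  | insert p s hp ih =>
    have hM' : (0 : ℝ) < M := by exact_mod_cast hM
    have ih' := fun S => ih (fun p hp => hy p (mem_insert_of_mem hp)) S
    have hyp := hy p (mem_insert_self _ _)
    -- `φ` omits the term of the new page `p`; that term is bounded separately in `h6` by the
    -- marginal of `p` at `S`.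
    set φ : Finset P → ℝ := fun S' => g S' + ∑ p ∈ s, (y p : ℝ) / M * (g S' - g (S'.erase p))
      with hφ
    have h1 : ∀ θ : P → Fin M, ∀ v : Fin M,
        φ (S \ hitSet y (Function.update θ p v) (insert p s)) =
          if (v : ℕ) < y p then φ (S.erase p \ hitSet y θ s) else φ (S \ hitSet y θ s) := by
      intro θ v
      have h2 : hitSet y (Function.update θ p v) s = hitSet y θ s := by
        apply Finset.filter_congr
        intro r hr
        have : r ≠ p := fun h => hp (h ▸ hr)
        simp [this]
      have h3 : hitSet y (Function.update θ p v) (insert p s) =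
          if (v : ℕ) < y p then insert p (hitSet y θ s) else hitSet y θ s := by
        rw [← h2]
        unfold hitSet
        rw [Finset.filter_insert]
        simp
      rw [h3]
      split_ifs
      · congr 1
        ext r
        simp only [mem_sdiff, mem_insert, mem_erase]
        tauto
      · rfl
    have h4 : (M : ℝ) * ∑ θ : P → Fin M, φ (S \ hitSet y θ (insert p s)) ≤
        Fintype.card (P → Fin M) * (y p * g (S.erase p) + (M - y p) * g S) := by
      have := sum_sum_update p (fun θ : P → Fin M => φ (S \ hitSet y θ (insert p s)))
      rw [Fintype.card_fin] at this
      rw [← this]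
      simp only [h1]
      have h5 : ∀ a b : ℝ, (∑ v : Fin M, if (v : ℕ) < y p then a else b) =
          y p * a + (M - y p) * b := by
        intro a b
        have hc : (univ.filter fun v : Fin M => (v : ℕ) < y p).card = y p := by
          rw [Fin.card_filter_val_lt]
          omega
        have hc2 : (univ.filter fun v : Fin M => ¬ (v : ℕ) < y p).card = M - y p := by
          have := Finset.card_filter_add_card_filter_not (s := (univ : Finset (Fin M)))
            (fun v : Fin M => (v : ℕ) < y p)
          rw [hc, card_univ, Fintype.card_fin] at this
          omega
        rw [Finset.sum_ite, sum_const, sum_const, hc, hc2]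
        simp [Nat.cast_sub hyp]
      simp only [h5, sum_add_distrib, ← mul_sum]
      have a1 := mul_le_mul_of_nonneg_left (ih' (S.erase p)) (Nat.cast_nonneg (α := ℝ) (y p))
      have a2 := mul_le_mul_of_nonneg_left (ih' S)
        (sub_nonneg.2 (Nat.cast_le (α := ℝ).2 hyp))
      calc _ ≤ _ := add_le_add a1 a2
        _ = _ := by ring
    have h6 : ∀ θ : P → Fin M, (g (S \ hitSet y θ (insert p s)) + ∑ r ∈ insert p s,
        (y r : ℝ) / M * (g (S \ hitSet y θ (insert p s)) -
          g ((S \ hitSet y θ (insert p s)).erase r))) ≤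
        φ (S \ hitSet y θ (insert p s)) + y p / M * (g S - g (S.erase p)) := by
      intro θ
      rw [sum_insert hp]
      have := mul_le_mul_of_nonneg_left (hg p _ _ (sdiff_subset (s := S)
        (t := hitSet y θ (insert p s)))) (by positivity : (0 : ℝ) ≤ y p / M)
      simp only [hφ]
      linarith
    refine (sum_le_sum fun θ _ => h6 θ).trans ?_
    rw [sum_add_distrib, sum_const, card_univ, nsmul_eq_mul]
    rw [← mul_le_mul_iff_right₀ hM']
    calc _ = (M : ℝ) * ∑ θ : P → Fin M, φ (S \ hitSet y θ (insert p s)) +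
          Fintype.card (P → Fin M) * (y p * (g S - g (S.erase p))) := by field_simp
      _ ≤ _ := by linarith

/-- The pages of `S` that no round of sampling hits. -/
def unhit {M N : ℕ} (y : P → ℕ) (θ : Fin N → P → Fin M) (S : Finset P) : Finset P :=
  S.filter fun p => ∀ i, y p ≤ θ i p

/-- The covering inequality holds for every subset of `S₀`, in particular for what survives a round.
There the marginal sum in `sum_hitSet_le` is at least a second copy of `g`, so every round halves
the expectation. -/
theorem sum_unhit_le {M : ℕ} (hM : 0 < M) {g : Finset P → ℝ} (hg : MonotoneMarginals g)
    (y : P → ℕ) (S₀ : Finset P) (hy : ∀ p ∈ S₀, y p ≤ M)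
    (hcover : ∀ S ⊆ S₀, g S ≤ ∑ p ∈ S, (y p : ℝ) / M * (g S - g (S.erase p))) (N : ℕ) :
    ∀ S ⊆ S₀, 2 ^ N * ∑ θ : Fin N → P → Fin M, g (unhit y θ S) ≤
      Fintype.card (Fin N → P → Fin M) * g S := by
  induction N with
  | zero => intro S _; simp [unhit]
  | succ N ih =>
    intro S hS
    have key : ∀ S ⊆ S₀, 2 * ∑ a : P → Fin M, g (S \ hitSet y a S₀) ≤
        Fintype.card (P → Fin M) * g S := by
      intro S hS
      refine le_trans ?_ (sum_hitSet_le hM hg y S₀ hy S)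
      rw [mul_sum]
      refine sum_le_sum fun a _ => ?_
      have h1 := hcover (S \ hitSet y a S₀) (sdiff_subset.trans hS)
      -- Marginals vanish outside the set, so the sum may run over all of `S₀`.
      have h2 : ∑ p ∈ S \ hitSet y a S₀, (y p : ℝ) / M *
          (g (S \ hitSet y a S₀) - g ((S \ hitSet y a S₀).erase p)) =
          ∑ p ∈ S₀, (y p : ℝ) / M *
          (g (S \ hitSet y a S₀) - g ((S \ hitSet y a S₀).erase p)) := by
        refine sum_subset (sdiff_subset.trans hS) fun p _ hp => ?_
        rw [erase_eq_of_notMem hp]; simp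
      linarith
    have hsplit : ∑ θ : Fin (N + 1) → P → Fin M, g (unhit y θ S) =
        ∑ a : P → Fin M, ∑ θ : Fin N → P → Fin M, g (unhit y θ (S \ hitSet y a S₀)) := by
      rw [← Equiv.sum_comp (Fin.consEquiv fun _ => P → Fin M), Fintype.sum_prod_type]
      refine sum_congr rfl fun a _ => sum_congr rfl fun θ _ => ?_
      congr 1
      ext p
      simp only [unhit, hitSet, mem_filter, mem_sdiff, Fin.consEquiv_apply, Fin.forall_fin_succ,
        Fin.cons_zero, Fin.cons_succ]
      constructor
      · rintro ⟨h1, h2, h3⟩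
        exact ⟨⟨h1, fun h => by omega⟩, h3⟩
      · rintro ⟨⟨h1, h2⟩, h3⟩
        exact ⟨h1, by by_contra h; exact h2 ⟨hS h1, by omega⟩, h3⟩
    rw [hsplit]
    have hc : (Fintype.card (Fin (N + 1) → P → Fin M) : ℝ) =
        Fintype.card (Fin N → P → Fin M) * Fintype.card (P → Fin M) := by
      simp [pow_succ]
    calc _ = 2 * ∑ a : P → Fin M, 2 ^ N * ∑ θ : Fin N → P → Fin M,
          g (unhit y θ (S \ hitSet y a S₀)) := by rw [← mul_sum, pow_succ]; ring
      _ ≤ 2 * ∑ a : P → Fin M, Fintype.card (Fin N → P → Fin M) * g (S \ hitSet y a S₀) := by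
          exact mul_le_mul_of_nonneg_left
            (sum_le_sum fun a _ => ih _ (sdiff_subset.trans hS)) (by norm_num)
      _ = Fintype.card (Fin N → P → Fin M) * (2 * ∑ a : P → Fin M, g (S \ hitSet y a S₀)) := by
          rw [← mul_sum]; ring
      _ ≤ _ := by
          rw [hc, mul_assoc]
          exact mul_le_mul_of_nonneg_left (key S hS) (Nat.cast_nonneg _)

/-- A fixed threshold separates two given levels with probability at most their distance. -/
theorem sum_level_crossed_le {M N : ℕ} (hM : 0 < M) (p : P) (a b : ℕ) :
    ∑ θ : Fin N → P → Fin M, (if (∃ i, (θ i p : ℕ) < b) ∧ ¬ ∃ i, (θ i p : ℕ) < a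
      then (1 : ℝ) else 0) ≤ Fintype.card (Fin N → P → Fin M) * (N * ((b - a : ℕ) : ℝ) / M) := by
  set h : Fin M → ℝ := fun v => if (v : ℕ) < b ∧ a ≤ v then 1 else 0
  have hM' : (0 : ℝ) < M := by exact_mod_cast hM
  have hcount : ∑ v, h v ≤ ((b - a : ℕ) : ℝ) := by
    simp only [h, sum_boole]
    have : ((univ.filter fun v : Fin M => (v : ℕ) < b ∧ a ≤ v).map Fin.valEmbedding) ⊆
        Finset.Ico a b := by
      intro n
      simp only [mem_map, mem_filter, mem_univ, true_and, mem_Ico]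
      rintro ⟨v, hv, rfl⟩
      exact ⟨hv.2, hv.1⟩
    have := card_le_card this
    rw [card_map, Nat.card_Ico] at this
    exact_mod_cast this
  have hone : ∀ i : Fin N, ∑ θ : Fin N → P → Fin M, h (θ i p) ≤
      Fintype.card (Fin N → P → Fin M) * (((b - a : ℕ) : ℝ) / M) := by
    intro i
    have h1 := card_mul_sum_apply i (fun v : P → Fin M => h (v p))
    have h2 := card_mul_sum_apply p h
    rw [Fintype.card_fin] at h2
    have : Nonempty (P → Fin M) := ⟨fun _ => ⟨0, hM⟩⟩
    have hV : (0 : ℝ) < Fintype.card (P → Fin M) := by exact_mod_cast Fintype.card_pos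
    have h3 : ∑ v : P → Fin M, h (v p) ≤ Fintype.card (P → Fin M) * (((b - a : ℕ) : ℝ) / M) := by
      rw [← mul_le_mul_iff_right₀ hM', h2]
      calc _ ≤ (Fintype.card (P → Fin M) : ℝ) * ((b - a : ℕ) : ℝ) := by gcongr
        _ = _ := by field_simp
    rw [← mul_le_mul_iff_right₀ hV, h1]
    calc _ ≤ (Fintype.card (Fin N → P → Fin M) : ℝ) *
          (Fintype.card (P → Fin M) * (((b - a : ℕ) : ℝ) / M)) := by gcongr
      _ = _ := by ring
  calc _ ≤ ∑ θ : Fin N → P → Fin M, ∑ i, h (θ i p) := by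
        refine sum_le_sum fun θ _ => ?_
        have hnn : ∀ i ∈ (univ : Finset (Fin N)), 0 ≤ h (θ i p) := fun i _ => by
          simp only [h]; split_ifs <;> norm_num
        split_ifs with hc
        · obtain ⟨⟨i, hi⟩, hn⟩ := hc
          push Not at hn
          have : h (θ i p) = 1 := by simp [h, hi, hn i]
          rw [← this]
          exact single_le_sum hnn (mem_univ i)
        · exact sum_nonneg hnn
    _ = ∑ i, ∑ θ : Fin N → P → Fin M, h (θ i p) := sum_comm
    _ ≤ ∑ i : Fin N, Fintype.card (Fin N → P → Fin M) * (((b - a : ℕ) : ℝ) / M) :=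
        sum_le_sum fun i _ => hone i
    _ = _ := by rw [sum_const, card_univ, Fintype.card_fin, nsmul_eq_mul]; ring

end Sampling

/-! ### Online covering by multiplicative updates. -/

section Fractional

open Finset

variable {P : Type u} [Fintype P] [DecidableEq P]

/-- The covering rows with coefficients in `[0, 1]` and at most `d` non-zero entries that are
valid for the indicator of every set in `F`. -/
def IsValidRow (F : Set (Finset P)) (d : ℕ) (a : P → ℝ) : Prop :=
  (∀ p, 0 ≤ a p ∧ a p ≤ 1) ∧ (univ.filter fun p => a p ≠ 0).card ≤ d ∧
    ∀ E ∈ F, 1 ≤ ∑ p ∈ E, a p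

/-- All rows supported on the pages of value less than `1 / 2` are satisfied. -/
def SatisfiesRows (F : Set (Finset P)) (d : ℕ) (x : P → ℝ) : Prop :=
  ∀ a, IsValidRow F d a → (∀ p, a p ≠ 0 → x p < 1 / 2) → 1 ≤ ∑ p, a p * x p

theorem half_le_log_one_add {z : ℝ} (h0 : 0 ≤ z) (h1 : z ≤ 1) : z / 2 ≤ Real.log (1 + z) := by
  have h := Real.one_sub_inv_le_log_of_pos (show 0 < 1 + z by linarith)
  refine le_trans ?_ h
  rw [← sub_nonneg]
  have : 1 - (1 + z)⁻¹ - z / 2 = z * (1 - z) / (2 * (1 + z)) := by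
    field_simp
    ring
  rw [this]
  exact div_nonneg (mul_nonneg h0 (by linarith)) (by linarith)

/-- One multiplicative update along a violated row. -/
theorem exists_update_step {c : P → ℝ} {ε : ℝ} (hε : 0 < ε) (hεc : ∀ p, 4 * ε ≤ c p)
    {d : ℕ} (hd : 0 < d) {p₀ : P} {F : Set (Finset P)} (hF : ∀ E ∈ F, p₀ ∉ E)
    (hne : F.Nonempty) {η : ℝ} (hη : ∀ p, η ≤ ε / (d * c p))
    {x : P → ℝ} (hx₀ : x p₀ = 0) (hx : ∀ p, 0 ≤ x p ∧ x p ≤ 1) {a : P → ℝ}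
    (ha : IsValidRow F d a) (hsupp : ∀ p, a p ≠ 0 → x p < 1 / 2) (hviol : ∑ p, a p * x p < 1) :
    ∃ x' : P → ℝ, x' p₀ = 0 ∧ (∀ p, x p ≤ x' p) ∧ (∀ p, x' p ≤ 1) ∧
      (∑ p, x p) + η ≤ ∑ p, x' p ∧
      ∀ E ∈ F, ∑ p, c p * (x' p - x p) ≤
        4 * ∑ p ∈ E, c p * (Real.log (x' p + 1 / d) - Real.log (x p + 1 / d)) := by
  have hd' : (0 : ℝ) < d := by exact_mod_cast hd
  have hd1 : (1 : ℝ) / d ≤ 1 := by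
    rw [div_le_one hd']; exact_mod_cast hd
  have hdpos : (0 : ℝ) < 1 / d := by positivity
  have hc : ∀ p, 0 < c p := fun p => by linarith [hεc p]
  obtain ⟨ha1, ha2, ha3⟩ := ha
  -- The summand `1 / d` lets absences grow from 0; over at most `d` entries it costs no more than
  -- `ε` in total.
  set w : P → ℝ := fun p => if p = p₀ ∨ a p = 0 then 0 else ε * (a p * x p + 1 / d) / c p with hw
  have hw0 : ∀ p, 0 ≤ w p := by
    intro p
    simp only [hw]
    split_ifs
    · exact le_rfl
    · exact div_nonneg (mul_nonneg hε.le (add_nonneg (mul_nonneg (ha1 p).1 (hx p).1) hdpos.le))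
        (hc p).le
  have hwE : ∀ p, p ≠ p₀ → a p ≠ 0 → w p = ε * (a p * x p + 1 / d) / c p := fun p h1 h2 => by
    simp [hw, h1, h2]
  refine ⟨fun p => x p + w p, by simp [hw, hx₀], fun p => by simpa using hw0 p, fun p => ?_, ?_, ?_⟩
  · by_cases h : p = p₀ ∨ a p = 0
    · simpa [hw, h] using (hx p).2
    · push Not at h
      have h1 := hsupp p h.2
      -- Rows live on pages with `x p < 1 / 2`, so a step of at most `1 / 2` cannot exceed 1; this
      -- is why `4 * ε ≤ c p` is required.
      have h2 : w p ≤ 1 / 2 := by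
        rw [hwE p h.1 h.2, div_le_iff₀ (hc p)]
        have : a p * x p ≤ 1 := by nlinarith [ha1 p, hx p]
        nlinarith [hεc p]
      show x p + w p ≤ 1
      linarith
  · obtain ⟨E, hE⟩ := hne
    have : ∃ p ∈ E, a p ≠ 0 := by
      by_contra hcon
      push Not at hcon
      have := ha3 E hE
      rw [sum_eq_zero hcon] at this
      linarith
    obtain ⟨p, hpE, hpa⟩ := this
    have hpp : p ≠ p₀ := fun h => hF E hE (h ▸ hpE)
    have h1 : w p ≤ ∑ p, w p := single_le_sum (fun p _ => hw0 p) (mem_univ p)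
    have h2 : ε / (d * c p) ≤ w p := by
      rw [hwE p hpp hpa]
      have : ε / (d * c p) = ε * (1 / d) / c p := by field_simp
      rw [this]
      have := hc p
      gcongr
      have := mul_nonneg (ha1 p).1 (hx p).1
      linarith
    rw [sum_add_distrib]
    linarith [hη p]
  · intro E hE
    -- One `ε` comes from the violated row, whose value is below 1, and one from the additive terms.
    have hcost : ∑ p, c p * (x p + w p - x p) ≤ 2 * ε := by
      calc _ ≤ ∑ p, (ε * (a p * x p) + if a p ≠ 0 then ε * (1 / d) else 0) := by
            refine sum_le_sum fun p _ => ?_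
            have hn := mul_nonneg hε.le (mul_nonneg (ha1 p).1 (hx p).1)
            by_cases h : p = p₀ ∨ a p = 0
            · have : w p = 0 := by simp only [hw, if_pos h]
              rw [this]
              have : (0 : ℝ) ≤ if a p ≠ 0 then ε * (1 / d) else 0 := by
                split_ifs <;> positivity
              simp only [add_zero, sub_self, mul_zero]
              linarith
            · push Not at h
              rw [hwE p h.1 h.2, if_pos h.2]
              have := (hc p).ne'
              apply le_of_eq
              field_simp
              ring
        _ = ε * ∑ p, a p * x p + (univ.filter fun p => a p ≠ 0).card * (ε * (1 / d)) := by
            rw [sum_add_distrib, mul_sum, ← sum_filter, sum_const, nsmul_eq_mul]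
        _ ≤ ε * 1 + d * (ε * (1 / d)) := by gcongr
        _ = 2 * ε := by field_simp; ring
    refine hcost.trans ?_
    -- Since `a p ≤ 1`, the shifted value `x p + 1 / d` grows at least by the factor `1 + ε * a p /
    -- c p`. Summed over `E` the gain is at least `ε / 2`, because the row is valid for `E`.
    have hdrop : ∀ p ∈ E, ε * a p / 2 ≤
        c p * (Real.log (x p + w p + 1 / d) - Real.log (x p + 1 / d)) := by
      intro p hp
      have hpp : p ≠ p₀ := fun h => hF E hE (h ▸ hp)
      by_cases h : a p = 0
      · have : w p = 0 := by simp [hw, h]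
        simp [this, h]
      · have hpos : 0 < x p + 1 / d := add_pos_of_nonneg_of_pos (hx p).1 hdpos
        have hz : ε * a p / c p ≤ 1 := by
          rw [div_le_one (hc p)]
          nlinarith [hεc p, ha1 p]
        have hz0 : 0 ≤ ε * a p / c p :=
          div_nonneg (mul_nonneg hε.le (ha1 p).1) (hc p).le
        have h1 : (x p + 1 / d) * (1 + ε * a p / c p) ≤ x p + w p + 1 / d := by
          have : (x p + 1 / d) * (ε * a p / c p) ≤ w p := by
            rw [hwE p hpp h, mul_div_assoc', div_le_div_iff_of_pos_right (hc p)]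
            have : a p * (1 / d) ≤ 1 * (1 / d) := by gcongr; exact (ha1 p).2
            nlinarith
          linarith
        have h2 : Real.log (x p + 1 / d) + Real.log (1 + ε * a p / c p) ≤
            Real.log (x p + w p + 1 / d) := by
          rw [← Real.log_mul hpos.ne' (by linarith)]
          exact Real.log_le_log (by positivity) h1
        have h3 := half_le_log_one_add hz0 hz
        have h4 : c p * (ε * a p / c p / 2) = ε * a p / 2 := by
          have := (hc p).ne'
          field_simp
        rw [← h4]
        have := hc p
        gcongr
        linarith
    have h5 := sum_le_sum hdrop
    rw [← sum_div, ← mul_sum] at h5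
    have h6 := mul_le_mul_of_nonneg_left (ha3 E hE) hε.le
    linarith

/-- Repeated updates satisfy all rows; their cost is paid by a logarithmic potential. -/
theorem exists_satisfiesRows {c : P → ℝ} (hc : ∀ p, 0 < c p) {d : ℕ} (hd : 0 < d) {p₀ : P}
    {F : Set (Finset P)} (hF : ∀ E ∈ F, p₀ ∉ E) (hne : F.Nonempty)
    {x : P → ℝ} (hx₀ : x p₀ = 0) (hx : ∀ p, 0 ≤ x p ∧ x p ≤ 1) :
    ∃ x' : P → ℝ, x' p₀ = 0 ∧ (∀ p, x p ≤ x' p) ∧ (∀ p, x' p ≤ 1) ∧ SatisfiesRows F d x' ∧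
      ∀ E ∈ F, ∑ p, c p * (x' p - x p) ≤
        4 * ∑ p ∈ E, c p * (Real.log (x' p + 1 / d) - Real.log (x p + 1 / d)) := by
  have hd' : (0 : ℝ) < d := by exact_mod_cast hd
  obtain ⟨q, -, hq⟩ := exists_min_image univ c ⟨p₀, mem_univ _⟩
  obtain ⟨r, -, hr⟩ := exists_max_image univ c ⟨p₀, mem_univ _⟩
  set ε := c q / 4
  have hε : 0 < ε := by have := hc q; positivity
  have hεc : ∀ p, 4 * ε ≤ c p := fun p => by
    have := hq p (mem_univ p)
    simp only [ε]; linarith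
  set η := ε / (d * c r)
  have hη0 : 0 < η := by have := hc r; positivity
  have hη : ∀ p, η ≤ ε / (d * c p) := fun p => by
    have h1 := hr p (mem_univ p)
    have h2 := hc p
    simp only [η]
    gcongr
  -- Termination: each update raises `∑ p, x p` by at least `η`, while this sum never exceeds the
  -- number of pages.
  have main : ∀ m : ℕ, ∀ x : P → ℝ, x p₀ = 0 → (∀ p, 0 ≤ x p ∧ x p ≤ 1) →
      Fintype.card P ≤ (∑ p, x p) + m * η →
      ∃ x' : P → ℝ, x' p₀ = 0 ∧ (∀ p, x p ≤ x' p) ∧ (∀ p, x' p ≤ 1) ∧ SatisfiesRows F d x' ∧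
        ∀ E ∈ F, ∑ p, c p * (x' p - x p) ≤
          4 * ∑ p ∈ E, c p * (Real.log (x' p + 1 / d) - Real.log (x p + 1 / d)) := by
    intro m
    induction m with
    | zero =>
      intro x hx₀ hx hsum
      by_cases hsat : SatisfiesRows F d x
      · exact ⟨x, hx₀, fun _ => le_rfl, fun p => (hx p).2, hsat, by simp⟩
      · unfold SatisfiesRows at hsat
        push Not at hsat
        obtain ⟨a, ha, hsupp, hviol⟩ := hsat
        obtain ⟨x₁, -, -, h3, h4, -⟩ :=
          exists_update_step hε hεc hd hF hne hη hx₀ hx ha hsupp hviol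
        have : ∑ p, x₁ p ≤ ∑ p : P, (1 : ℝ) := sum_le_sum fun p _ => h3 p
        simp at this hsum
        linarith
    | succ m ih =>
      intro x hx₀ hx hsum
      by_cases hsat : SatisfiesRows F d x
      · exact ⟨x, hx₀, fun _ => le_rfl, fun p => (hx p).2, hsat, by simp⟩
      · unfold SatisfiesRows at hsat
        push Not at hsat
        obtain ⟨a, ha, hsupp, hviol⟩ := hsat
        obtain ⟨x₁, h1, h2, h3, h4, h5⟩ :=
          exists_update_step hε hεc hd hF hne hη hx₀ hx ha hsupp hviol
        obtain ⟨x', g1, g2, g3, g4, g5⟩ := ih x₁ h1 (fun p => ⟨(hx p).1.trans (h2 p), h3 p⟩)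
          (by push_cast at hsum; linarith)
        refine ⟨x', g1, fun p => (h2 p).trans (g2 p), g3, g4, fun E hE => ?_⟩
        have e1 : ∑ p, c p * (x' p - x p) =
            ∑ p, c p * (x' p - x₁ p) + ∑ p, c p * (x₁ p - x p) := by
          rw [← sum_add_distrib]
          exact sum_congr rfl fun p _ => by ring
        have e2 : ∑ p ∈ E, c p * (Real.log (x' p + 1 / d) - Real.log (x p + 1 / d)) =
            ∑ p ∈ E, c p * (Real.log (x' p + 1 / d) - Real.log (x₁ p + 1 / d)) +
            ∑ p ∈ E, c p * (Real.log (x₁ p + 1 / d) - Real.log (x p + 1 / d)) := by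
          rw [← sum_add_distrib]
          exact sum_congr rfl fun p _ => by ring
        rw [e1, e2]
        linarith [g5 E hE, h5 E hE]
  obtain ⟨m, hm⟩ := exists_nat_ge (Fintype.card P / η)
  refine main m x hx₀ hx ?_
  rw [div_le_iff₀ hη0] at hm
  have : 0 ≤ ∑ p, x p := sum_nonneg fun p _ => (hx p).1
  linarith

end Fractional

/-! ### Covering inequalities from supermodularity. -/

section Algorithm

open Finset

namespace PagingInstance

variable {P : Type u} [Fintype P] [DecidableEq P] (I : PagingInstance P)

/-- The amount by which a set of pages exceeds the cache threshold. -/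
def excess (S : Finset P) : ℝ := ((I.f S - I.k : ℕ) : ℝ)

variable {I}

theorem excess_nonneg (S : Finset P) : 0 ≤ I.excess S := Nat.cast_nonneg _

theorem excess_eq_zero {S : Finset P} (h : I.f S ≤ I.k) : I.excess S = 0 := by
  simp [excess, h]

theorem le_of_excess_le_zero {S : Finset P} (h : I.excess S ≤ 0) : I.f S ≤ I.k := by
  have h' : I.f S - I.k ≤ 0 := by unfold excess at h; exact_mod_cast h
  omega

theorem one_le_excess {S : Finset P} (h : ¬ I.f S ≤ I.k) : 1 ≤ I.excess S := by
  have : 1 ≤ I.f S - I.k := by omega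
  unfold excess
  exact_mod_cast this

theorem excess_mono {S S' : Finset P} (h : S ⊆ S') : I.excess S ≤ I.excess S' := by
  have := I.mono _ _ h
  unfold excess
  gcongr

theorem excess_le (S : Finset P) : I.excess S ≤ I.f univ := by
  have h1 := I.mono _ _ (subset_univ S)
  have : I.f S - I.k ≤ I.f univ := by omega
  unfold excess
  exact_mod_cast this

/-- Truncation at `k` is convex and nondecreasing, so for monotone `f` it preserves supermodularity,
applied here to `S'` and `S.erase p`. -/
theorem monotoneMarginals_excess (hI : IsSupermodular I.f) : MonotoneMarginals I.excess := by
  intro p S' S hS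
  by_cases hp : p ∈ S'
  · have h1 := hI S' (S.erase p)
    have e1 : S' ∪ S.erase p = S := by
      ext r
      have := @hS r
      simp only [mem_union, mem_erase]
      constructor
      · tauto
      · intro hr
        by_cases h : r = p
        · exact Or.inl (h ▸ hp)
        · exact Or.inr ⟨h, hr⟩
    have e2 : S' ∩ S.erase p = S'.erase p := by
      ext r
      have := @hS r
      simp only [mem_inter, mem_erase]
      tauto
    rw [e1, e2] at h1
    have h2 := I.mono _ _ (erase_subset p S')
    have h3 := I.mono _ _ (erase_subset_erase p hS)
    have h4 := I.mono _ _ hS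
    have h5 := I.mono _ _ (erase_subset p S)
    have : (I.f S' - I.k) + (I.f (S.erase p) - I.k) ≤
        (I.f S - I.k) + (I.f (S'.erase p) - I.k) := by omega
    have : I.excess S' + I.excess (S.erase p) ≤ I.excess S + I.excess (S'.erase p) := by
      unfold excess
      exact_mod_cast this
    linarith
  · rw [erase_eq_of_notMem hp, sub_self, sub_nonneg]
    exact excess_mono (erase_subset _ _)

theorem marginal_nonneg (S : Finset P) (p : P) : 0 ≤ I.excess S - I.excess (S.erase p) :=
  sub_nonneg.2 (excess_mono (erase_subset _ _))

/-- Removing a set `T` from `S` decreases a supermodular function by at most the sum of the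
marginals of `T` at `S`. -/
theorem sub_sdiff_le_sum_marginals {g : Finset P → ℝ} (hg : MonotoneMarginals g)
    (S T : Finset P) : g S - g (S \ T) ≤ ∑ p ∈ T, (g S - g (S.erase p)) := by
  induction T using Finset.induction_on with
  | empty => simp
  | insert p T hp ih =>
    rw [sum_insert hp]
    have h1 : S \ insert p T = (S \ T).erase p := by
      ext r; simp only [mem_sdiff, mem_insert, mem_erase]; tauto
    have := hg p (S \ T) S sdiff_subset
    rw [h1]
    linarith

theorem card_le_mu {S : Finset P} (h : I.f S ≤ I.k) : S.card ≤ I.mu :=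
  Finset.le_sup (f := Finset.card) (by simp [h])

theorem mu_pos [Nonempty P] : 0 < I.mu := by
  obtain ⟨p⟩ := ‹Nonempty P›
  have := card_le_mu (I.single_le p)
  simp at this
  omega

variable (I)

/-- The sets of pages that may be absent from the cache right after `p₀` was served. -/
def absentSets (p₀ : P) : Set (Finset P) := {E | p₀ ∉ E ∧ I.f Eᶜ ≤ I.k}

/-- The pages of fractional absence less than `1 / 2`. -/
noncomputable def light (x : P → ℝ) : Finset P := univ.filter fun p => x p < 1 / 2

/-- The consequences of the row constraints that are used for rounding. -/
def IsCovering (x : P → ℝ) : Prop :=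
  (light x).card ≤ 2 * I.mu ∧ ∀ S ⊆ light x,
    I.excess S ≤ ∑ p ∈ S, x p * (I.excess S - I.excess (S.erase p))

variable {I}

theorem compl_singleton_mem_absentSets (p₀ : P) : ({p₀}ᶜ : Finset P) ∈ I.absentSets p₀ := by
  simp [absentSets, I.single_le p₀]

/-- Two kinds of rows suffice: a uniform one limits the light pages, and then the normalised
marginals of a set of light pages form a row that is short enough. -/
theorem isCovering_of_satisfiesRows [Nonempty P] (hI : IsSupermodular I.f) {p₀ : P} {x : P → ℝ}
    (h : SatisfiesRows (I.absentSets p₀) (2 * I.mu) x) : I.IsCovering x := by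
  have hmu := I.mu_pos
  have hmu' : (0 : ℝ) < I.mu := by exact_mod_cast hmu
  have hcard : (light x).card ≤ 2 * I.mu := by
    by_contra hcon
    push Not at hcon
    obtain ⟨S, hS, hSc⟩ := exists_subset_card_eq hcon.le
    -- A feasible cache holds at most μ of the 2μ pages of `S`, so at least μ are absent. Yet the
    -- light values make this row less than 2μ · (1/μ) · (1/2) = 1.
    have hrow : IsValidRow (I.absentSets p₀) (2 * I.mu)
        (fun p => if p ∈ S then (1 : ℝ) / I.mu else 0) := by
      refine ⟨fun p => ?_, ?_, ?_⟩
      · beta_reduce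
        split_ifs
        · refine ⟨by positivity, ?_⟩
          rw [div_le_one hmu']
          exact_mod_cast hmu
        · norm_num
      · rw [← hSc]
        refine card_le_card fun p => ?_
        simp only [mem_filter, mem_univ, true_and]
        intro hp
        by_contra hpS
        simp [hpS] at hp
      · rintro E ⟨-, hE⟩
        rw [← sum_filter, sum_const, nsmul_eq_mul]
        have h1 : (S ∩ Eᶜ).card ≤ I.mu :=
          (card_le_card inter_subset_right).trans (card_le_mu hE)
        have h2 : (E.filter (· ∈ S)).card + (S ∩ Eᶜ).card = S.card := by
          rw [← card_union_of_disjoint]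
          · congr 1
            ext p; simp only [mem_union, mem_filter, mem_inter, mem_compl]; tauto
          · rw [disjoint_left]
            intro p; simp only [mem_filter, mem_inter, mem_compl]; tauto
        have h3 : I.mu ≤ (E.filter (· ∈ S)).card := by omega
        rw [mul_one_div, le_div_iff₀ hmu', one_mul]
        exact_mod_cast h3
    have hlt : ∀ p ∈ S, x p < 1 / 2 := fun p hp => by
      have := hS hp
      simpa [light] using this
    have h1 := h _ hrow (fun p hp => hlt p (by
      by_contra hpS
      simp [hpS] at hp))
    have h2 : ∑ p, (if p ∈ S then (1 : ℝ) / I.mu else 0) * x p = ∑ p ∈ S, 1 / I.mu * x p := by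
      simp only [ite_mul, zero_mul]
      rw [← sum_filter]
      congr 1
      ext; simp
    have hne : S.Nonempty := by rw [← card_pos]; omega
    have h3 : ∑ p ∈ S, 1 / (I.mu : ℝ) * x p < ∑ p ∈ S, 1 / (I.mu : ℝ) * (1 / 2) :=
      sum_lt_sum_of_nonempty hne fun p hp => by
        have := hlt p hp
        gcongr
    rw [sum_const, hSc, nsmul_eq_mul] at h3
    have h4 : ((2 * I.mu : ℕ) : ℝ) * (1 / (I.mu : ℝ) * (1 / 2)) = 1 := by
      push_cast; field_simp
    linarith
  refine ⟨hcard, fun S hS => ?_⟩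
  rcases (excess_nonneg (I := I) S).eq_or_lt with h0 | hpos
  · rw [← h0]
    have : ∀ p ∈ S, I.excess (S.erase p) = 0 := fun p _ =>
      le_antisymm (h0 ▸ excess_mono (erase_subset _ _)) (excess_nonneg _)
    rw [sum_eq_zero fun p hp => by rw [this p hp]; simp]
  -- Validity: `S \ E` lies in a feasible cache, so removing `E` must eliminate the whole excess of
  -- `S`.
  · set a : P → ℝ := fun p => (I.excess S - I.excess (S.erase p)) / I.excess S with ha
    have ha0 : ∀ p, p ∉ S → a p = 0 := fun p hp => by
      simp [ha, erase_eq_of_notMem hp]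
    have hrow : IsValidRow (I.absentSets p₀) (2 * I.mu) a := by
      refine ⟨fun p => ⟨div_nonneg (marginal_nonneg _ _) hpos.le, ?_⟩, ?_, ?_⟩
      · rw [div_le_one hpos]
        have := excess_nonneg (I := I) (S.erase p)
        linarith
      · refine le_trans (card_le_card fun p => ?_) ((card_le_card hS).trans hcard)
        simp only [mem_filter, mem_univ, true_and]
        intro hp
        by_contra hpS
        exact hp (ha0 p hpS)
      · rintro E ⟨-, hE⟩
        have h1 := sub_sdiff_le_sum_marginals (monotoneMarginals_excess hI) S E
        have h2 : I.excess (S \ E) = 0 := by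
          apply excess_eq_zero
          refine (I.mono _ _ ?_).trans hE
          intro p
          simp
        rw [h2, sub_zero] at h1
        rw [← sum_div, le_div_iff₀ hpos]
        linarith
    have h1 := h a hrow (fun p hp => by
      have hpS : p ∈ S := by
        by_contra hpS
        exact hp (ha0 p hpS)
      simpa [light] using hS hpS)
    have h2 : ∑ p ∈ S, x p * (I.excess S - I.excess (S.erase p)) =
        I.excess S * ∑ p, a p * x p := by
      rw [mul_sum, ← sum_subset (subset_univ S) fun p _ hp => by rw [ha0 p hp]; simp]
      refine sum_congr rfl fun p _ => ?_
      simp only [ha]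
      field_simp
    rw [h2]
    nlinarith

theorem exists_nextFrac [Nonempty P] (I : PagingInstance P) (x : P → ℝ)
    (hx : ∀ p, 0 ≤ x p ∧ x p ≤ 1) (p₀ : P) :
    ∃ x' : P → ℝ, x' p₀ = 0 ∧ (∀ p, Function.update x p₀ 0 p ≤ x' p) ∧ (∀ p, x' p ≤ 1) ∧
      SatisfiesRows (I.absentSets p₀) (2 * I.mu) x' ∧
      ∀ E ∈ I.absentSets p₀, ∑ p, I.c p * (x' p - Function.update x p₀ 0 p) ≤
        4 * ∑ p ∈ E, I.c p * (Real.log (x' p + 1 / (2 * I.mu : ℕ)) -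
          Real.log (Function.update x p₀ 0 p + 1 / (2 * I.mu : ℕ))) := by
  refine exists_satisfiesRows I.c_pos (by have := I.mu_pos; omega) (fun E hE => hE.1)
    ⟨_, compl_singleton_mem_absentSets p₀⟩ (by simp) fun p => ?_
  by_cases h : p = p₀
  · subst h; simp
  · simpa [h] using hx p

/-! ### The online algorithm and its feasibility. -/

/-- The fractional absences after the request `p₀`. -/
noncomputable def nextFrac [Nonempty P] (I : PagingInstance P) (x : P → ℝ) (p₀ : P) : P → ℝ :=
  open Classical in
  -- The default `x` never occurs along a run, by `frac_mem`.
  if hx : ∀ p, 0 ≤ x p ∧ x p ≤ 1 then (exists_nextFrac I x hx p₀).choose else x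

/-- The fractional absences after a request sequence; pages not yet requested are absent. -/
noncomputable def frac [Nonempty P] (I : PagingInstance P) (σ : List P) : P → ℝ :=
  σ.foldl I.nextFrac fun _ => 1

/-- Fractional absences, doubled and rounded down to multiples of `1 / (2 * I.mu)`. -/
noncomputable def level (I : PagingInstance P) (x : P → ℝ) (p : P) : ℕ :=
  ⌊2 * (2 * I.mu : ℕ) * x p⌋₊

/-- The pages allowed in the cache: the ones not hit by the sampling, or, if these do not fit, the
pages of level `0`. -/
def target (I : PagingInstance P) {M N : ℕ} (y : P → ℕ) (θ : Fin N → P → Fin M) : Finset P :=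
  if I.f (unhit y θ univ) ≤ I.k then unhit y θ univ else univ.filter fun p => y p = 0

/-- The cache contents for fixed sampling thresholds. -/
noncomputable def roundedCache [Nonempty P] (I : PagingInstance P) {M N : ℕ}
    (θ : Fin N → P → Fin M) (σ : List P) : Finset P :=
  (σ.foldl (fun z p => (I.nextFrac z.1 p,
    insert p z.2 ∩ I.target (I.level (I.nextFrac z.1 p)) θ)) ((fun _ => 1 : P → ℝ), ∅)).2

variable [Nonempty P]

theorem frac_append (σ : List P) (p : P) : I.frac (σ ++ [p]) = I.nextFrac (I.frac σ) p := by
  simp [frac]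

theorem roundedCache_nil {M N : ℕ} (θ : Fin N → P → Fin M) : I.roundedCache θ [] = ∅ := rfl

theorem roundedCache_append {M N : ℕ} (θ : Fin N → P → Fin M) (σ : List P) (p : P) :
    I.roundedCache θ (σ ++ [p]) =
      insert p (I.roundedCache θ σ) ∩ I.target (I.level (I.frac (σ ++ [p]))) θ := by
  have h : ∀ (σ : List P) (z : (P → ℝ) × Finset P), (σ.foldl (fun z p => (I.nextFrac z.1 p,
      insert p z.2 ∩ I.target (I.level (I.nextFrac z.1 p)) θ)) z).1 = σ.foldl I.nextFrac z.1 := by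
    intro σ
    induction σ with
    | nil => intro z; rfl
    | cons q σ ih => intro z; simp [ih]
  simp only [roundedCache, frac, List.foldl_append, List.foldl_cons, List.foldl_nil, h]

theorem nextFrac_spec {x : P → ℝ} (hx : ∀ p, 0 ≤ x p ∧ x p ≤ 1) (p₀ : P) :
    I.nextFrac x p₀ p₀ = 0 ∧ (∀ p, Function.update x p₀ 0 p ≤ I.nextFrac x p₀ p) ∧
      (∀ p, I.nextFrac x p₀ p ≤ 1) ∧
      SatisfiesRows (I.absentSets p₀) (2 * I.mu) (I.nextFrac x p₀) ∧
      ∀ E ∈ I.absentSets p₀, ∑ p, I.c p * (I.nextFrac x p₀ p - Function.update x p₀ 0 p) ≤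
        4 * ∑ p ∈ E, I.c p * (Real.log (I.nextFrac x p₀ p + 1 / (2 * I.mu : ℕ)) -
          Real.log (Function.update x p₀ 0 p + 1 / (2 * I.mu : ℕ))) := by
  have : I.nextFrac x p₀ = (exists_nextFrac I x hx p₀).choose := by
    unfold nextFrac
    rw [dif_pos hx]
  rw [this]
  exact (exists_nextFrac I x hx p₀).choose_spec

theorem nextFrac_mem {x : P → ℝ} (hx : ∀ p, 0 ≤ x p ∧ x p ≤ 1) (p₀ : P) :
    ∀ p, 0 ≤ I.nextFrac x p₀ p ∧ I.nextFrac x p₀ p ≤ 1 := by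
  obtain ⟨-, h2, h3, -⟩ := nextFrac_spec (I := I) hx p₀
  refine fun p => ⟨le_trans ?_ (h2 p), h3 p⟩
  by_cases h : p = p₀
  · subst h; simp
  · simpa [h] using (hx p).1

theorem frac_mem (σ : List P) : ∀ p, 0 ≤ I.frac σ p ∧ I.frac σ p ≤ 1 := by
  induction σ using List.reverseRecOn with
  | nil => intro p; simp [frac]
  | append_singleton σ q ih => rw [frac_append]; exact nextFrac_mem ih q

theorem isCovering_frac_append (hI : IsSupermodular I.f) (σ : List P) (p : P) :
    I.IsCovering (I.frac (σ ++ [p])) := by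
  rw [frac_append]
  exact isCovering_of_satisfiesRows hI (nextFrac_spec (frac_mem σ) p).2.2.2.1

theorem isCovering_frac (hI : IsSupermodular I.f) (σ : List P) : I.IsCovering (I.frac σ) := by
  induction σ using List.reverseRecOn with
  | nil =>
    have : light (I.frac ([] : List P)) = ∅ := by
      ext p; simp [light, frac]; norm_num
    refine ⟨by simp [this], fun S hS => ?_⟩
    rw [this, subset_empty] at hS
    subst hS
    obtain ⟨p⟩ := ‹Nonempty P›
    rw [excess_eq_zero ((I.mono _ _ (empty_subset {p})).trans (I.single_le p))]
    simp
  | append_singleton σ q _ => exact isCovering_frac_append hI σ q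

theorem level_lt_iff {x : P → ℝ} {p : P} (hx : 0 ≤ x p) :
    I.level x p < 2 * I.mu ↔ x p < 1 / 2 := by
  have h : (0 : ℝ) < (2 * I.mu : ℕ) := by have := I.mu_pos; exact_mod_cast (by omega)
  unfold level
  rw [Nat.floor_lt (by positivity)]
  constructor
  · intro h1; by_contra h2; push Not at h2; nlinarith
  · intro h1; nlinarith

/-- Doubling `x` covers the excess twice. Rounding down loses at most 1 / (2μ) of a marginal for
each of at most 2μ light pages, hence at most one copy of the excess. -/
theorem IsCovering.le_sum_level {x : P → ℝ} (hcov : I.IsCovering x) {S : Finset P}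
    (hS : S ⊆ light x) : I.excess S ≤ ∑ p ∈ S, (I.level x p : ℝ) / (2 * I.mu : ℕ) *
      (I.excess S - I.excess (S.erase p)) := by
  set M := 2 * I.mu with hM
  have hpos : (0 : ℝ) < M := by have := I.mu_pos; exact_mod_cast (by omega)
  have h1 : ∀ p ∈ S, (2 * x p - 1 / M) * (I.excess S - I.excess (S.erase p)) ≤
      (I.level x p : ℝ) / M * (I.excess S - I.excess (S.erase p)) := by
    intro p _
    refine mul_le_mul_of_nonneg_right ?_ (marginal_nonneg _ _)
    have := Nat.lt_floor_add_one (2 * (M : ℝ) * x p)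
    rw [le_div_iff₀ hpos]
    have e : (2 * x p - 1 / M) * M = 2 * M * x p - 1 := by field_simp
    rw [e]
    unfold level
    linarith
  refine le_trans ?_ (sum_le_sum h1)
  have h2 : ∑ p ∈ S, (1 / (M : ℝ)) * (I.excess S - I.excess (S.erase p)) ≤ I.excess S := by
    calc _ ≤ ∑ p ∈ S, (1 / (M : ℝ)) * I.excess S := by
          gcongr with p
          have := excess_nonneg (I := I) (S.erase p)
          linarith
      _ = S.card * (1 / (M : ℝ)) * I.excess S := by
          rw [sum_const, nsmul_eq_mul]; ring
      _ ≤ 1 * I.excess S := by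
          refine mul_le_mul_of_nonneg_right ?_ (excess_nonneg _)
          rw [mul_one_div, div_le_one hpos]
          exact_mod_cast (card_le_card hS).trans hcov.1
      _ = _ := one_mul _
  have h3 := hcov.2 S hS
  have h4 : ∑ p ∈ S, (2 * x p - 1 / M) * (I.excess S - I.excess (S.erase p)) =
      2 * ∑ p ∈ S, x p * (I.excess S - I.excess (S.erase p)) -
      ∑ p ∈ S, (1 / (M : ℝ)) * (I.excess S - I.excess (S.erase p)) := by
    rw [mul_sum, ← sum_sub_distrib]
    exact sum_congr rfl fun p _ => by ring
  linarith

/-- On these pages the right side of the rounded covering inequality is zero, which makes the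
fallback of `target` safe. -/
theorem IsCovering.zero_level_feasible {x : P → ℝ} (hx : ∀ p, 0 ≤ x p)
    (hcov : I.IsCovering x) : I.f (univ.filter fun p => I.level x p = 0) ≤ I.k := by
  apply le_of_excess_le_zero
  have hsub : (univ.filter fun p => I.level x p = 0) ⊆ light x := by
    intro p
    simp only [mem_filter, mem_univ, true_and, light]
    intro hp
    rw [← level_lt_iff (I := I) (hx p), hp]
    have := I.mu_pos
    omega
  refine (hcov.le_sum_level hsub).trans (le_of_eq (sum_eq_zero fun p hp => ?_))
  simp only [mem_filter, mem_univ, true_and] at hp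
  simp [hp]

theorem IsCovering.target_feasible {x : P → ℝ} (hx : ∀ p, 0 ≤ x p) (hcov : I.IsCovering x)
    {M N : ℕ} (θ : Fin N → P → Fin M) : I.f (I.target (I.level x) θ) ≤ I.k := by
  unfold target
  split_ifs with h
  · exact h
  · exact hcov.zero_level_feasible hx

theorem mem_target {M N : ℕ} {y : P → ℕ} {p : P} (h : y p = 0) (θ : Fin N → P → Fin M) :
    p ∈ I.target y θ := by
  unfold target
  split_ifs <;> simp [unhit, h]

theorem target_subset_unhit {M N : ℕ} (y : P → ℕ) (θ : Fin N → P → Fin M) :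
    I.target y θ ⊆ unhit y θ univ := by
  unfold target
  split_ifs
  · exact Subset.rfl
  · intro p
    simp only [unhit, mem_filter, mem_univ, true_and]
    intro h; simp [h]

theorem level_frac_self (σ : List P) (p : P) : I.level (I.frac (σ ++ [p])) p = 0 := by
  rw [frac_append, level, (nextFrac_spec (frac_mem σ) p).1]
  simp

variable (I) in
/-- The online algorithm for fixed sampling thresholds. -/
noncomputable def roundedAlgorithm (hI : IsSupermodular I.f) {M N : ℕ} (θ : Fin N → P → Fin M) :
    I.OnlineAlgorithm where
  cache := I.roundedCache θ
  serves := by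
    intro σ
    refine ⟨by simp [roundedCache_nil], fun i hi => ?_⟩
    beta_reduce
    rw [List.take_succ_eq_append_getElem hi, roundedCache_append]
    refine ⟨?_, inter_subset_left, ?_⟩
    · rw [mem_inter]
      exact ⟨mem_insert_self _ _, mem_target (level_frac_self _ _) θ⟩
    · exact (I.mono _ _ inter_subset_right).trans
        ((isCovering_frac hI _).target_feasible (fun p => (frac_mem _ p).1) θ)

variable (I) in
/-- The online algorithm with uniformly random sampling thresholds. -/
noncomputable def sampledAlgorithm (hI : IsSupermodular I.f) (N : ℕ) : I.RandomizedAlgorithm :=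
  have : Nonempty (Fin N → P → Fin (2 * I.mu)) :=
    ⟨fun _ _ => ⟨0, by have := I.mu_pos; omega⟩⟩
  letI : MeasurableSpace (Fin N → P → Fin (2 * I.mu)) := ⊤
  { Ω := Fin N → P → Fin (2 * I.mu)
    prob := (PMF.uniformOfFintype (Fin N → P → Fin (2 * I.mu))).toMeasure
    alg := I.roundedAlgorithm hI
    measurable_cache := fun _ _ => trivial }

theorem expectedCost_sampledAlgorithm (hI : IsSupermodular I.f) (N : ℕ) (σ : List P) :
    Fintype.card (Fin N → P → Fin (2 * I.mu)) * I.expectedCost (I.sampledAlgorithm hI N) σ =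
      ∑ θ : Fin N → P → Fin (2 * I.mu), I.cost σ.length fun i => I.roundedCache θ (σ.take i) := by
  have hne : Nonempty (Fin N → P → Fin (2 * I.mu)) :=
    ⟨fun _ _ => ⟨0, by have := I.mu_pos; omega⟩⟩
  let _ : MeasurableSpace (Fin N → P → Fin (2 * I.mu)) := ⊤
  have hms : MeasurableSingletonClass (Fin N → P → Fin (2 * I.mu)) := ⟨fun _ => trivial⟩
  have h : I.expectedCost (I.sampledAlgorithm hI N) σ =
      ∫ θ, I.cost σ.length (fun i => I.roundedCache θ (σ.take i))
        ∂(PMF.uniformOfFintype (Fin N → P → Fin (2 * I.mu))).toMeasure := rfl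
  rw [h, PMF.integral_eq_sum, mul_sum]
  refine sum_congr rfl fun θ _ => ?_
  have : (Fintype.card (Fin N → P → Fin (2 * I.mu)) : ℝ) ≠ 0 := by
    exact_mod_cast Fintype.card_ne_zero
  rw [PMF.uniformOfFintype_apply, ENNReal.toReal_inv, ENNReal.toReal_natCast, smul_eq_mul,
    mul_inv_cancel_left₀ this]

end PagingInstance

end Algorithm

/-! ### Failure probability and evictions of one step. -/

section Analysis

open Finset

namespace PagingInstance

variable {P : Type u} [Fintype P] [DecidableEq P] {I : PagingInstance P} [Nonempty P]

theorem unhit_level_subset_light {x : P → ℝ} (hx : ∀ p, 0 ≤ x p) {N : ℕ} (hN : 0 < N)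
    (θ : Fin N → P → Fin (2 * I.mu)) : unhit (I.level x) θ univ ⊆ light x := by
  intro p
  simp only [unhit, light, mem_filter, mem_univ, true_and]
  intro h
  rw [← level_lt_iff (I := I) (hx p)]
  exact (h ⟨0, hN⟩).trans_lt (θ ⟨0, hN⟩ p).2

/-- The sampling leaves an infeasible set with probability at most `f univ / 2 ^ N`. -/
theorem sum_infeasible_le (hI : IsSupermodular I.f) {x : P → ℝ} (hx : ∀ p, 0 ≤ x p)
    (hcov : I.IsCovering x) {N : ℕ} (hN : 0 < N) :
    2 ^ N * ∑ θ : Fin N → P → Fin (2 * I.mu),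
      (if I.f (unhit (I.level x) θ univ) ≤ I.k then (0 : ℝ) else 1) ≤
      Fintype.card (Fin N → P → Fin (2 * I.mu)) * I.f univ := by
  have hM : 0 < 2 * I.mu := by have := I.mu_pos; omega
  have hy : ∀ p ∈ light x, I.level x p ≤ 2 * I.mu := fun p hp => by
    rw [light, mem_filter] at hp
    exact ((level_lt_iff (hx p)).2 hp.2).le
  have h := sum_unhit_le hM (monotoneMarginals_excess hI) (I.level x) (light x) hy
    (fun S hS => hcov.le_sum_level hS) N (light x) Subset.rfl
  refine le_trans ?_ (h.trans (mul_le_mul_of_nonneg_left (excess_le _) (Nat.cast_nonneg _)))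
  refine mul_le_mul_of_nonneg_left (sum_le_sum fun θ _ => ?_) (by positivity)
  split_ifs with hf
  · exact excess_nonneg _
  · refine one_le_excess fun hf' => hf ((I.mono _ _ ?_).trans hf')
    intro p hp
    have := unhit_level_subset_light hx hN θ hp
    simp only [unhit, mem_filter, mem_univ, true_and] at hp ⊢
    exact ⟨this, hp⟩

/-- Levels of at least 2μ exceed every threshold, so nothing is random and only level 0 stays unhit.
This excludes failures before the first level rise. -/
theorem feasible_of_levels_trivial {x : P → ℝ} (hx : ∀ p, 0 ≤ x p) (hcov : I.IsCovering x)
    (h : ∀ p, I.level x p = 0 ∨ 2 * I.mu ≤ I.level x p) {N : ℕ} (hN : 0 < N)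
    (θ : Fin N → P → Fin (2 * I.mu)) : I.f (unhit (I.level x) θ univ) ≤ I.k := by
  refine (I.mono _ _ fun p hp => ?_).trans (hcov.zero_level_feasible hx)
  simp only [unhit, mem_filter, mem_univ, true_and] at hp ⊢
  have := hp ⟨0, hN⟩
  have := (θ ⟨0, hN⟩ p).2
  have := h p
  omega

theorem le_cmax (p : P) : I.c p ≤ I.cmax := le_sup' I.c (mem_univ p)

theorem cmin_le (p : P) : I.cmin ≤ I.c p := inf'_le I.c (mem_univ p)

theorem cmin_pos : 0 < I.cmin := by
  unfold cmin
  rw [lt_inf'_iff]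
  exact fun p _ => I.c_pos p

theorem cmax_pos : 0 < I.cmax := by
  obtain ⟨p⟩ := ‹Nonempty P›
  exact (I.c_pos p).trans_le (le_cmax p)

/-- The evictions of a single step, for fixed thresholds: pages that become hit, or everything
if the levels change and the sampling leaves an infeasible set. -/
theorem sum_evicted_le {M N : ℕ} {y y' : P → ℕ} (θ : Fin N → P → Fin M) {C : Finset P} (p₀ : P)
    (hC : C ⊆ I.target y θ) (hfeas : I.f C ≤ I.k) :
    ∑ p ∈ C \ (insert p₀ C ∩ I.target y' θ), I.c p ≤
      ∑ p, I.c p * (if (∃ i, (θ i p : ℕ) < y' p) ∧ ¬ ∃ i, (θ i p : ℕ) < y p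
        then (1 : ℝ) else 0) +
      (if y = y' then 0 else I.mu * I.cmax) *
        (if I.f (unhit y' θ univ) ≤ I.k then (0 : ℝ) else 1) := by
  have hnn : 0 ≤ ∑ p, I.c p * (if (∃ i, (θ i p : ℕ) < y' p) ∧ ¬ ∃ i, (θ i p : ℕ) < y p
        then (1 : ℝ) else 0) := sum_nonneg fun p _ => by
    have := I.c_pos p
    split_ifs <;> simp [this.le]
  by_cases hyy : y = y'
  · subst hyy
    have : C \ (insert p₀ C ∩ I.target y θ) = ∅ := by
      rw [sdiff_eq_empty_iff_subset]
      exact fun p hp => mem_inter.2 ⟨mem_insert_of_mem hp, hC hp⟩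
    rw [this]
    simpa using hnn
  · by_cases hgood : I.f (unhit y' θ univ) ≤ I.k
    · have ht : I.target y' θ = unhit y' θ univ := if_pos hgood
      rw [ht, if_pos hgood, mul_zero, add_zero]
      simp only [mul_ite, mul_one, mul_zero]
      rw [← sum_filter]
      refine sum_le_sum_of_subset_of_nonneg (fun p hp => ?_) fun p _ _ => (I.c_pos p).le
      simp only [mem_sdiff, mem_inter, mem_insert, not_and] at hp
      have h1 := hp.2 (Or.inr hp.1)
      have h2 := target_subset_unhit y θ (hC hp.1)
      simp only [unhit, mem_filter, mem_univ, true_and] at h1 h2 ⊢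
      push Not at h1 ⊢
      exact ⟨h1, h2⟩
    · rw [if_neg hyy, if_neg hgood, mul_one]
      have h1 : ∑ p ∈ C \ (insert p₀ C ∩ I.target y' θ), I.c p ≤ ∑ p ∈ C, I.c p :=
        sum_le_sum_of_subset_of_nonneg sdiff_subset fun p _ _ => (I.c_pos p).le
      have h2 : ∑ p ∈ C, I.c p ≤ C.card * I.cmax := by
        rw [← nsmul_eq_mul]
        exact sum_le_card_nsmul _ _ _ fun p _ => le_cmax p
      have h3 : (C.card : ℝ) * I.cmax ≤ I.mu * I.cmax := by
        have := I.cmax_pos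
        have := card_le_mu hfeas
        gcongr
      linarith

/-! ### Amortised bound on the level rises. -/

variable (I) in
/-- The weighted increase of the levels between two fractional states. -/
noncomputable def levelRise (x x' : P → ℝ) : ℝ :=
  ∑ p, I.c p * ((I.level x' p - I.level x p : ℕ) : ℝ)

variable (I) in
/-- The weighted rounding error of the levels. -/
noncomputable def levelGap (x : P → ℝ) : ℝ :=
  ∑ p, I.c p * (2 * (2 * I.mu : ℕ) * x p - I.level x p)

variable (I) in
/-- The logarithmic potential of a fractional state relative to a set `E` of absent pages. -/
noncomputable def potential (E : Finset P) (x : P → ℝ) : ℝ :=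
  ∑ p ∈ E, I.c p *
    (Real.log (1 + 1 / (2 * I.mu : ℕ)) - Real.log (x p + 1 / (2 * I.mu : ℕ)))

theorem level_le {x : P → ℝ} {p : P} (hx : 0 ≤ x p) :
    (I.level x p : ℝ) ≤ 2 * (2 * I.mu : ℕ) * x p := Nat.floor_le (by positivity)

theorem level_nextFrac_self {x : P → ℝ} (hx : ∀ p, 0 ≤ x p ∧ x p ≤ 1) (p₀ : P) :
    I.level (I.nextFrac x p₀) p₀ = 0 := by
  rw [level, (nextFrac_spec hx p₀).1]
  simp

theorem level_le_level_nextFrac {x : P → ℝ} (hx : ∀ p, 0 ≤ x p ∧ x p ≤ 1) {p₀ p : P}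
    (h : p ≠ p₀) : I.level x p ≤ I.level (I.nextFrac x p₀) p := by
  have := (nextFrac_spec (I := I) hx p₀).2.1 p
  rw [Function.update_of_ne h] at this
  unfold level
  gcongr

/-- The gap stores fractional movement not yet visible in the levels. For `p ≠ p₀` this is an
identity; the reset of `p₀` only discards its gap. -/
theorem levelRise_add_levelGap_le {x : P → ℝ} (hx : ∀ p, 0 ≤ x p ∧ x p ≤ 1) (p₀ : P) :
    I.levelRise x (I.nextFrac x p₀) + I.levelGap (I.nextFrac x p₀) ≤
      2 * (2 * I.mu : ℕ) * ∑ p, I.c p * (I.nextFrac x p₀ p - Function.update x p₀ 0 p) +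
        I.levelGap x := by
  unfold levelRise levelGap
  rw [mul_sum, ← sum_add_distrib, ← sum_add_distrib]
  refine sum_le_sum fun p _ => ?_
  have hc := I.c_pos p
  by_cases h : p = p₀
  · subst h
    have := level_le (I := I) (hx p).1
    rw [level_nextFrac_self hx, (nextFrac_spec hx p).1]
    simp only [zero_tsub, Nat.cast_zero, mul_zero, sub_self, Function.update_self, zero_add]
    exact mul_nonneg hc.le (sub_nonneg.2 this)
  · have := level_le_level_nextFrac (I := I) hx h
    rw [Function.update_of_ne h, Nat.cast_sub this]
    apply le_of_eq
    ring

theorem potential_term_nonneg {x : P → ℝ} (hx : ∀ p, 0 ≤ x p ∧ x p ≤ 1) (p : P) :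
    0 ≤ I.c p * (Real.log (1 + 1 / (2 * I.mu : ℕ)) - Real.log (x p + 1 / (2 * I.mu : ℕ))) := by
  have h : (0 : ℝ) < (2 * I.mu : ℕ) := by have := I.mu_pos; exact_mod_cast (by omega)
  have h' : (0 : ℝ) < 1 / (2 * I.mu : ℕ) := by positivity
  refine mul_nonneg (I.c_pos p).le (sub_nonneg.2 (Real.log_le_log ?_ ?_))
  · linarith [(hx p).1]
  · linarith [(hx p).2]

/-- The fractional movement of a step is paid by the drop of the potential and the evictions of an
arbitrary competitor. -/
theorem raise_le {x : P → ℝ} (hx : ∀ p, 0 ≤ x p ∧ x p ≤ 1) {p₀ : P} {C C' : Finset P}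
    (hmem : p₀ ∈ C') (hf : I.f C' ≤ I.k) :
    ∑ p, I.c p * (I.nextFrac x p₀ p - Function.update x p₀ 0 p) ≤
      4 * (I.potential Cᶜ x - I.potential C'ᶜ (I.nextFrac x p₀) +
        Real.log (1 + (2 * I.mu : ℕ)) * ∑ p ∈ C \ C', I.c p) := by
  have hE : C'ᶜ ∈ I.absentSets p₀ := by simp [absentSets, hmem, hf]
  refine ((nextFrac_spec hx p₀).2.2.2.2 _ hE).trans ?_
  set d : ℝ := ((2 * I.mu : ℕ) : ℝ) with hd
  have hdpos : 0 < d := by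
    rw [hd]
    have := I.mu_pos
    exact_mod_cast (by omega : 0 < 2 * I.mu)
  set t : P → ℝ := fun p => I.c p * (Real.log (1 + 1 / d) - Real.log (x p + 1 / d)) with ht
  have h1 : ∑ p ∈ C'ᶜ, I.c p * (Real.log (I.nextFrac x p₀ p + 1 / d) -
      Real.log (Function.update x p₀ 0 p + 1 / d)) =
      ∑ p ∈ C'ᶜ, t p - I.potential C'ᶜ (I.nextFrac x p₀) := by
    unfold potential
    rw [← sum_sub_distrib]
    refine sum_congr rfl fun p hp => ?_
    have : p ≠ p₀ := fun h => by subst h; simp [hmem] at hp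
    rw [Function.update_of_ne this]
    simp only [ht]
    ring
  -- Absent pages of the competitor were absent before, and are paid by the old potential, or have
  -- just been evicted at a charge of at most `log (1 + d)` times their cost.
  have h2 : ∑ p ∈ C'ᶜ, t p = ∑ p ∈ C'ᶜ ∩ Cᶜ, t p + ∑ p ∈ C \ C', t p := by
    rw [← sum_union]
    · congr 1
      ext p; simp only [mem_union, mem_inter, mem_compl, mem_sdiff]; tauto
    · rw [disjoint_left]
      intro p; simp only [mem_inter, mem_compl, mem_sdiff]; tauto
  have h3 : ∑ p ∈ C'ᶜ ∩ Cᶜ, t p ≤ I.potential Cᶜ x :=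
    sum_le_sum_of_subset_of_nonneg inter_subset_right fun p _ _ => potential_term_nonneg hx p
  have h4 : ∑ p ∈ C \ C', t p ≤ Real.log (1 + d) * ∑ p ∈ C \ C', I.c p := by
    rw [mul_sum]
    refine sum_le_sum fun p _ => ?_
    rw [mul_comm (Real.log (1 + d))]
    refine mul_le_mul_of_nonneg_left ?_ (I.c_pos p).le
    have e : 1 + 1 / d = (1 + d) * (1 / d) := by field_simp; ring
    have h5 : Real.log (1 / d) ≤ Real.log (x p + 1 / d) :=
      Real.log_le_log (by positivity) (by linarith [(hx p).1])
    rw [e, Real.log_mul (by positivity) (by positivity)]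
    linarith
  linarith

variable (I) in
/-- The fractional state after the first `i` requests. -/
noncomputable def fracAt (σ : List P) (i : ℕ) : P → ℝ := I.frac (σ.take i)

theorem fracAt_succ {σ : List P} {i : ℕ} (hi : i < σ.length) :
    I.fracAt σ (i + 1) = I.nextFrac (I.fracAt σ i) σ[i] := by
  unfold fracAt
  rw [List.take_succ_eq_append_getElem hi, frac_append]

theorem level_fracAt_zero (σ : List P) (p : P) : I.level (I.fracAt σ 0) p = 2 * (2 * I.mu) := by
  simp only [level, fracAt, List.take_zero, frac, List.foldl_nil, mul_one]
  exact_mod_cast Nat.floor_natCast (R := ℝ) (2 * (2 * I.mu))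

theorem sum_levelRise_le {σ : List P} {S : ℕ → Finset P} (hS : I.IsSchedule σ S) {i : ℕ}
    (hi : i ≤ σ.length) :
    ∑ j ∈ range i, I.levelRise (I.fracAt σ j) (I.fracAt σ (j + 1)) + I.levelGap (I.fracAt σ i) ≤
      2 * (2 * I.mu : ℕ) * (4 * (Real.log (1 + (2 * I.mu : ℕ)) * I.cost i S -
        I.potential (S i)ᶜ (I.fracAt σ i))) := by
  induction i with
  | zero =>
    have h1 : I.levelGap (I.fracAt σ 0) = 0 := by
      unfold levelGap
      refine sum_eq_zero fun p _ => ?_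
      rw [level_fracAt_zero]
      simp [fracAt, frac]
    have h2 : I.potential (S 0)ᶜ (I.fracAt σ 0) = 0 := by
      simp [potential, fracAt, frac]
    rw [h1, h2]
    simp [cost]
  | succ i ih =>
    have hi' : i < σ.length := hi
    have h0 := ih hi'.le
    have hx := frac_mem (I := I) (σ.take i)
    have h1 := levelRise_add_levelGap_le (I := I) hx σ[i]
    have h2 := raise_le (I := I) (C := S i) hx (hS.2 i hi').1 (hS.2 i hi').2.2
    change ∀ p, 0 ≤ I.fracAt σ i p ∧ I.fracAt σ i p ≤ 1 at hx
    have h3 : I.cost (i + 1) S = I.cost i S + ∑ p ∈ S i \ S (i + 1), I.c p := by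
      unfold cost
      rw [sum_range_succ]
    rw [sum_range_succ, h3, fracAt_succ hi']
    have h4 := mul_le_mul_of_nonneg_left h2
      (show (0 : ℝ) ≤ 2 * (2 * I.mu : ℕ) by positivity)
    unfold fracAt at h0 ⊢
    linarith

theorem levelGap_nonneg {x : P → ℝ} (hx : ∀ p, 0 ≤ x p) : 0 ≤ I.levelGap x :=
  sum_nonneg fun p _ => mul_nonneg (I.c_pos p).le (sub_nonneg.2 (level_le (hx p)))

theorem sum_levelRise_le_cost {σ : List P} {S : ℕ → Finset P} (hS : I.IsSchedule σ S) :
    ∑ j ∈ range σ.length, I.levelRise (I.fracAt σ j) (I.fracAt σ (j + 1)) ≤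
      (2 * I.mu : ℕ) * (8 * Real.log (1 + (2 * I.mu : ℕ)) * I.cost σ.length S) := by
  have h1 := sum_levelRise_le hS le_rfl
  have h2 := levelGap_nonneg (I := I) (x := I.fracAt σ σ.length) fun p => (frac_mem _ p).1
  have h3 : 0 ≤ I.potential (S σ.length)ᶜ (I.fracAt σ σ.length) :=
    sum_nonneg fun p _ => potential_term_nonneg (frac_mem _) p
  have h4 := mul_nonneg (show (0 : ℝ) ≤ 2 * (2 * I.mu : ℕ) by positivity) h3
  unfold fracAt at *
  linarith

/-! ### Counting level changes and summing the costs. -/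

/-- A change of levels is paid by level rises, or lowers the number of positive levels. -/
theorem changed_add_card_le {y y' : P → ℕ} {p₀ : P} (h₀ : y' p₀ = 0)
    (h : ∀ p, p ≠ p₀ → y p ≤ y' p) :
    (if y = y' then 0 else 1) + (univ.filter fun p => 0 < y' p).card ≤
      (univ.filter fun p => 0 < y p).card + 2 * ∑ p, (y' p - y p) := by
  set V := univ.filter fun p => 0 < y p with hV
  set D := univ.filter fun p => 0 < y' p - y p with hD
  have hDR : D.card ≤ ∑ p, (y' p - y p) := by
    rw [card_eq_sum_ones, hD, sum_filter]
    refine sum_le_sum fun p _ => ?_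
    split_ifs <;> omega
  have hsub : (univ.filter fun p => 0 < y' p) ⊆ V.erase p₀ ∪ D := by
    intro p
    simp only [hV, hD, mem_union, mem_erase, mem_filter, mem_univ, true_and]
    intro hp
    have : p ≠ p₀ := fun e => by subst e; omega
    have := h p this
    by_cases 0 < y p
    · left; tauto
    · right; omega
  have hcard := (card_le_card hsub).trans (card_union_le _ _)
  have herase := card_erase_le (s := V) (a := p₀)
  split_ifs with hyy
  · omega
  · by_cases hp₀ : 0 < y p₀
    · have : p₀ ∈ V := by simp [hV, hp₀]
      have := card_erase_add_one this
      omega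
    · have : ∃ p, y p ≠ y' p := by
        by_contra hcon
        push Not at hcon
        exact hyy (funext hcon)
      obtain ⟨p, hp⟩ := this
      have hpp : p ≠ p₀ := fun e => by subst e; omega
      have h1 := h p hpp
      have h2 : y' p - y p ≤ ∑ p, (y' p - y p) :=
        single_le_sum (f := fun p => y' p - y p) (fun _ _ => Nat.zero_le _) (mem_univ p)
      omega

theorem level_fracAt_succ_self {σ : List P} {i : ℕ} (hi : i < σ.length) :
    I.level (I.fracAt σ (i + 1)) σ[i] = 0 := by
  rw [fracAt_succ hi]
  exact level_nextFrac_self (frac_mem _) _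

theorem level_fracAt_le_succ {σ : List P} {i : ℕ} (hi : i < σ.length) {p : P} (h : p ≠ σ[i]) :
    I.level (I.fracAt σ i) p ≤ I.level (I.fracAt σ (i + 1)) p := by
  rw [fracAt_succ hi]
  exact level_le_level_nextFrac (frac_mem _) h

variable (I) in
/-- The number of level rises during the first `i` requests. -/
noncomputable def riseCount (σ : List P) (i : ℕ) : ℕ :=
  ∑ j ∈ range i, ∑ p, (I.level (I.fracAt σ (j + 1)) p - I.level (I.fracAt σ j) p)

theorem riseCount_mono (σ : List P) {i j : ℕ} (h : i ≤ j) : I.riseCount σ i ≤ I.riseCount σ j :=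
  sum_le_sum_of_subset (range_mono h)

/-- The number of positive levels telescopes. It starts at most at |P| and always stays at least |P|
- μ, as the pages of level 0 form a feasible set. -/
theorem sum_changed_le (hI : IsSupermodular I.f) {σ : List P} {i : ℕ} (hi : i ≤ σ.length) :
    ∑ j ∈ range i, (if I.level (I.fracAt σ j) = I.level (I.fracAt σ (j + 1)) then 0 else 1) ≤
      I.mu + 2 * I.riseCount σ i := by
  have h : ∀ i ≤ σ.length, ∑ j ∈ range i,
      (if I.level (I.fracAt σ j) = I.level (I.fracAt σ (j + 1)) then 0 else 1) +
      (univ.filter fun p => 0 < I.level (I.fracAt σ i) p).card ≤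
      Fintype.card P + 2 * I.riseCount σ i := by
    intro i
    induction i with
    | zero =>
      intro _
      have := card_le_univ (univ.filter fun p => 0 < I.level (I.fracAt σ 0) p)
      simp only [range_zero, sum_empty]
      omega
    | succ i ih =>
      intro hi
      have h1 := ih (by omega)
      have h2 := changed_add_card_le (y := I.level (I.fracAt σ i)) (level_fracAt_succ_self hi)
        fun p hp => level_fracAt_le_succ hi hp
      have h3 : I.riseCount σ (i + 1) = I.riseCount σ i +
          ∑ p, (I.level (I.fracAt σ (i + 1)) p - I.level (I.fracAt σ i) p) := sum_range_succ _ _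
      rw [sum_range_succ]
      omega
  have h1 := h i hi
  have h2 : (univ.filter fun p => I.level (I.fracAt σ i) p = 0).card ≤ I.mu :=
    card_le_mu ((isCovering_frac hI _).zero_level_feasible fun p => (frac_mem _ p).1)
  have h3 := card_filter_add_card_filter_not (s := (univ : Finset P))
    fun p => I.level (I.fracAt σ i) p = 0
  rw [card_univ] at h3
  simp only [← Nat.pos_iff_ne_zero] at h3
  omega

theorem levels_trivial_of_riseCount_eq_zero {σ : List P} {i : ℕ} (hi : i ≤ σ.length)
    (h : I.riseCount σ i = 0) (p : P) :
    I.level (I.fracAt σ i) p = 0 ∨ 2 * I.mu ≤ I.level (I.fracAt σ i) p := by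
  induction i with
  | zero => right; rw [level_fracAt_zero]; omega
  | succ i ih =>
    have h3 : I.riseCount σ (i + 1) = I.riseCount σ i +
        ∑ p, (I.level (I.fracAt σ (i + 1)) p - I.level (I.fracAt σ i) p) := sum_range_succ _ _
    have h1 := ih (by omega) (by omega)
    by_cases hp : p = σ[i]
    · subst hp
      exact Or.inl (level_fracAt_succ_self hi)
    · have h2 := level_fracAt_le_succ (I := I) hi hp
      have h4 : I.level (I.fracAt σ (i + 1)) p - I.level (I.fracAt σ i) p ≤
          ∑ p, (I.level (I.fracAt σ (i + 1)) p - I.level (I.fracAt σ i) p) :=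
        single_le_sum (f := fun p => I.level (I.fracAt σ (i + 1)) p - I.level (I.fracAt σ i) p)
          (fun _ _ => Nat.zero_le _) (mem_univ p)
      omega

theorem cmin_mul_riseCount_le (σ : List P) (i : ℕ) : I.cmin * I.riseCount σ i ≤
    ∑ j ∈ range i, I.levelRise (I.fracAt σ j) (I.fracAt σ (j + 1)) := by
  unfold riseCount levelRise
  push_cast
  rw [mul_sum]
  refine sum_le_sum fun j _ => ?_
  rw [mul_sum]
  exact sum_le_sum fun p _ => mul_le_mul_of_nonneg_right (cmin_le p) (Nat.cast_nonneg _)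

theorem sum_step_cost_le (hI : IsSupermodular I.f) {N : ℕ} {σ : List P} {i : ℕ}
    (hi : i < σ.length) :
    ∑ θ : Fin N → P → Fin (2 * I.mu),
      ∑ p ∈ I.roundedCache θ (σ.take i) \ I.roundedCache θ (σ.take (i + 1)), I.c p ≤
    Fintype.card (Fin N → P → Fin (2 * I.mu)) * (N / (2 * I.mu : ℕ) *
      I.levelRise (I.fracAt σ i) (I.fracAt σ (i + 1))) +
    (if I.level (I.fracAt σ i) = I.level (I.fracAt σ (i + 1)) then 0 else I.mu * I.cmax) *
      ∑ θ : Fin N → P → Fin (2 * I.mu),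
        (if I.f (unhit (I.level (I.fracAt σ (i + 1))) θ univ) ≤ I.k then (0 : ℝ) else 1) := by
  have hM : 0 < 2 * I.mu := by have := I.mu_pos; omega
  have hpt : ∀ θ : Fin N → P → Fin (2 * I.mu), I.roundedCache θ (σ.take i) ⊆
      I.target (I.level (I.fracAt σ i)) θ ∧ I.f (I.roundedCache θ (σ.take i)) ≤ I.k := by
    intro θ
    have hsub : I.roundedCache θ (σ.take i) ⊆ I.target (I.level (I.fracAt σ i)) θ := by
      rcases i with _ | i
      · simp [roundedCache_nil]
      · rw [List.take_succ_eq_append_getElem (by omega), roundedCache_append]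
        unfold fracAt
        rw [List.take_succ_eq_append_getElem (by omega)]
        exact inter_subset_right
    exact ⟨hsub, (I.mono _ _ hsub).trans
      ((isCovering_frac hI _).target_feasible (fun p => (frac_mem _ p).1) θ)⟩
  have hstep : ∀ θ : Fin N → P → Fin (2 * I.mu), I.roundedCache θ (σ.take (i + 1)) =
      insert σ[i] (I.roundedCache θ (σ.take i)) ∩ I.target (I.level (I.fracAt σ (i + 1))) θ := by
    intro θ
    unfold fracAt
    rw [List.take_succ_eq_append_getElem hi, roundedCache_append]
  have h1 := sum_le_sum fun θ (_ : θ ∈ (univ : Finset (Fin N → P → Fin (2 * I.mu)))) =>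
    sum_evicted_le (y' := I.level (I.fracAt σ (i + 1))) θ σ[i] (hpt θ).1 (hpt θ).2
  simp only [hstep]
  refine h1.trans ?_
  rw [sum_add_distrib, ← mul_sum, sum_comm]
  refine add_le_add_left ?_ _
  unfold levelRise
  rw [mul_sum, mul_sum]
  refine sum_le_sum fun p _ => ?_
  rw [← mul_sum]
  refine (mul_le_mul_of_nonneg_left (sum_level_crossed_le hM p _ _) (I.c_pos p).le).trans ?_
  apply le_of_eq
  ring

/-- Newly hit pages cost N times the weighted rise over 2μ, and by the choice of N all failures
together cost at most one further such term. -/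
theorem expectedCost_le (hI : IsSupermodular I.f) {N : ℕ} (hN : 0 < N)
    (hNM : I.mu * (I.mu + 2) * (2 * I.mu : ℕ) * (I.cmax / I.cmin * I.f univ) ≤ (2 : ℝ) ^ N)
    {σ : List P} {S : ℕ → Finset P} (hS : I.IsSchedule σ S) :
    I.expectedCost (I.sampledAlgorithm hI N) σ ≤
      (N + 1) * (8 * Real.log (1 + (2 * I.mu : ℕ)) * I.cost σ.length S) := by
  have hM : (0 : ℝ) < (2 * I.mu : ℕ) := by have := I.mu_pos; exact_mod_cast (by omega)
  have hne : Nonempty (Fin N → P → Fin (2 * I.mu)) :=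
    ⟨fun _ _ => ⟨0, by have := I.mu_pos; omega⟩⟩
  set Λ : ℝ := (Fintype.card (Fin N → P → Fin (2 * I.mu)) : ℝ) with hΛ
  have hΛpos : 0 < Λ := by rw [hΛ]; exact_mod_cast Fintype.card_pos
  set D := ∑ j ∈ range σ.length, I.levelRise (I.fracAt σ j) (I.fracAt σ (j + 1)) with hD
  set R := I.riseCount σ σ.length with hR
  have hcmin := I.cmin_pos
  have hcmax := I.cmax_pos
  have hRD : I.cmin * R ≤ D := cmin_mul_riseCount_le σ _
  have hbad : ∀ j ∈ range σ.length, ∑ θ : Fin N → P → Fin (2 * I.mu),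
      (if I.f (unhit (I.level (I.fracAt σ (j + 1))) θ univ) ≤ I.k then (0 : ℝ) else 1) ≤
      if R = 0 then 0 else Λ * (I.f univ / 2 ^ N) := by
    intro j hj
    rw [mem_range] at hj
    have hcov : I.IsCovering (I.fracAt σ (j + 1)) := isCovering_frac hI _
    have hx : ∀ p, 0 ≤ I.fracAt σ (j + 1) p := fun p => (frac_mem _ p).1
    split_ifs with h
    · have h1 : I.riseCount σ (j + 1) = 0 :=
        Nat.le_zero.1 (h ▸ riseCount_mono σ (Nat.succ_le_of_lt hj))
      have h2 := levels_trivial_of_riseCount_eq_zero (Nat.succ_le_of_lt hj) h1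
      exact (sum_eq_zero fun θ _ => if_pos (feasible_of_levels_trivial hx hcov h2 hN θ)).le
    · have := sum_infeasible_le hI hx hcov hN
      rw [mul_div_assoc', le_div_iff₀ (by positivity), mul_comm]
      exact this
  have hchg : ∑ j ∈ range σ.length, (if I.level (I.fracAt σ j) = I.level (I.fracAt σ (j + 1))
      then (0 : ℝ) else I.mu * I.cmax) ≤ I.mu * I.cmax * (I.mu + 2 * R) := by
    have h1 := sum_changed_le hI (le_refl σ.length)
    have h2 : ∑ j ∈ range σ.length, (if I.level (I.fracAt σ j) = I.level (I.fracAt σ (j + 1))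
        then (0 : ℝ) else I.mu * I.cmax) = I.mu * I.cmax * ((∑ j ∈ range σ.length,
        (if I.level (I.fracAt σ j) = I.level (I.fracAt σ (j + 1)) then 0 else 1) : ℕ) : ℝ) := by
      push_cast
      rw [mul_sum]
      refine sum_congr rfl fun j _ => ?_
      split_ifs <;> simp
    rw [h2]
    refine mul_le_mul_of_nonneg_left ?_ (by positivity)
    exact_mod_cast h1
  have htotal : Λ * I.expectedCost (I.sampledAlgorithm hI N) σ ≤
      Λ * (N / (2 * I.mu : ℕ) * D) +
        I.mu * I.cmax * (I.mu + 2 * R) * (if R = 0 then 0 else Λ * (I.f univ / 2 ^ N)) := by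
    rw [hΛ, expectedCost_sampledAlgorithm]
    unfold cost
    rw [sum_comm]
    refine (sum_le_sum fun j hj => sum_step_cost_le hI (mem_range.1 hj)).trans ?_
    rw [sum_add_distrib, ← mul_sum, ← mul_sum]
    refine add_le_add_right ?_ _
    refine (sum_le_sum fun j hj => mul_le_mul_of_nonneg_left (hbad j hj) ?_).trans ?_
    · split_ifs <;> positivity
    · rw [← sum_mul]
      refine mul_le_mul_of_nonneg_right hchg ?_
      split_ifs <;> positivity
  -- The additive μ can be charged to rises only if `R ≥ 1`; for `R = 0` there are no failures.
  have hfall : I.mu * I.cmax * (I.mu + 2 * R) * (if R = 0 then 0 else Λ * (I.f univ / 2 ^ N)) ≤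
      Λ * (1 / (2 * I.mu : ℕ) * D) := by
    split_ifs with h
    · rw [mul_zero]
      have : 0 ≤ D := le_trans (by positivity) hRD
      positivity
    · have hR1 : (1 : ℝ) ≤ R := by exact_mod_cast Nat.one_le_iff_ne_zero.2 h
      have hmu : (0 : ℝ) ≤ I.mu := Nat.cast_nonneg _
      have h1 : (I.mu : ℝ) + 2 * R ≤ (I.mu + 2) * R := by nlinarith
      have h2 : (R : ℝ) ≤ D / I.cmin := by
        rw [le_div_iff₀ hcmin]; linarith
      have hD0 : 0 ≤ D := le_trans (by positivity) hRD
      calc _ ≤ I.mu * I.cmax * ((I.mu + 2) * (D / I.cmin)) * (Λ * (I.f univ / 2 ^ N)) := by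
            gcongr
            exact h1.trans (by gcongr)
        _ = Λ * (D / (2 * I.mu : ℕ)) * ((I.mu * (I.mu + 2) * (2 * I.mu : ℕ) *
              (I.cmax / I.cmin * I.f univ)) / 2 ^ N) := by
            field_simp
        _ ≤ Λ * (D / (2 * I.mu : ℕ)) * 1 := by
            gcongr
            rw [div_le_one (by positivity)]
            exact hNM
        _ = _ := by ring
  have h1 : I.expectedCost (I.sampledAlgorithm hI N) σ ≤ (N + 1) * (D / (2 * I.mu : ℕ)) := by
    rw [← mul_le_mul_iff_right₀ hΛpos]
    refine (htotal.trans (add_le_add_right hfall _)).trans (le_of_eq ?_)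
    ring
  refine h1.trans (mul_le_mul_of_nonneg_left ?_ (by positivity))
  rw [div_le_iff₀ hM, mul_comm]
  exact sum_levelRise_le_cost hS

theorem exists_rounds {m F : ℝ} (hm : 1 ≤ m) (hF : 1 ≤ F) :
    ∃ N : ℕ, 0 < N ∧ m * (m + 2) * (2 * m) * F ≤ 2 ^ N ∧
      (N + 1 : ℝ) ≤ 36 * (Real.log (1 + m) * Real.log (1 + F)) := by
  set A := m * (m + 2) * (2 * m) * F with hA
  have hA1 : 1 ≤ A := by
    rw [hA]
    have h1 : 1 ≤ m * (m + 2) := by nlinarith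
    have h2 : 1 ≤ m * (m + 2) * (2 * m) := by nlinarith
    nlinarith
  have hl : (1 : ℝ) / 2 < Real.log 2 := by linarith [Real.log_two_gt_d9]
  have ha : 1 / 2 ≤ Real.log (1 + m) :=
    hl.le.trans (Real.log_le_log (by norm_num) (by linarith))
  have hb : 1 / 2 ≤ Real.log (1 + F) :=
    hl.le.trans (Real.log_le_log (by norm_num) (by linarith))
  set a := Real.log (1 + m) with hadef
  set b := Real.log (1 + F) with hbdef
  have hlogA : Real.log A ≤ 6 * a + b := by
    have h1 : A ≤ (1 + m) ^ 6 * (1 + F) := by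
      have h3 : m * (m + 2) * (2 * m) ≤ (1 + m) ^ 6 := by
        have h4 : m * (m + 2) ≤ (1 + m) ^ 2 := by nlinarith
        have h5 : 2 * m ≤ (1 + m) ^ 2 := by nlinarith
        calc _ ≤ (1 + m) ^ 2 * (1 + m) ^ 2 := by gcongr
          _ = (1 + m) ^ 4 := by ring
          _ ≤ (1 + m) ^ 6 := pow_le_pow_right₀ (by linarith) (by norm_num)
      rw [hA]
      gcongr
      linarith
    have h2 := Real.log_le_log (by linarith) h1
    rw [Real.log_mul (x := (1 + m) ^ 6) (by positivity) (by positivity), Real.log_pow] at h2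
    exact_mod_cast h2
  have hA0 : 0 ≤ Real.log A := Real.log_nonneg hA1
  refine ⟨⌊Real.log A / Real.log 2⌋₊ + 1, by omega, ?_, ?_⟩
  · have h1 := Nat.lt_floor_add_one (Real.log A / Real.log 2)
    rw [div_lt_iff₀ (by linarith)] at h1
    rw [← Real.log_le_log_iff (by linarith) (by positivity), Real.log_pow]
    push_cast
    exact h1.le
  · have h1 := Nat.floor_le (div_nonneg hA0 (by linarith : (0 : ℝ) ≤ Real.log 2))
    have h2 : Real.log A / Real.log 2 ≤ 2 * Real.log A := by
      rw [div_le_iff₀ (by linarith)]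
      nlinarith
    push_cast
    -- With a, b ≥ 1/2: N + 1 ≤ 2(6a + b) + 2 ≤ (24 + 4 + 8)ab.
    nlinarith

end PagingInstance

end Analysis

theorem theorem1p6 :
    ∃ K : ℝ, 0 < K ∧
      ∀ (P : Type u) [Fintype P] [DecidableEq P] [Nonempty P] (I : PagingInstance P),
        IsSupermodular I.f →
          ∃ A : I.RandomizedAlgorithm,
            I.IsCompetitive A
              (K * Real.log (1 + (I.mu : ℝ)) ^ 2 *
                Real.log (1 + I.cmax / I.cmin * (I.f Finset.univ : ℝ))) := by
  -- 576 = 36 · 8 · 2: the rounds, the fractional bound, and log(1 + 2μ) ≤ 2 log(1 + μ).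
  refine ⟨576, by norm_num, fun P _ _ _ I hI => ?_⟩
  -- If `f` vanishes, the claimed ratio is 0; comparison with the schedule that never evicts shows
  -- that the expected cost is at most 0.
  rcases Nat.eq_zero_or_pos (I.f Finset.univ) with hf | hf
  · refine ⟨I.sampledAlgorithm hI 1, fun σ => ?_⟩
    have hS : I.IsSchedule σ fun i => (σ.take i).toFinset := by
      refine ⟨by simp, fun i hi => ?_⟩
      beta_reduce
      rw [List.take_succ_eq_append_getElem hi]
      refine ⟨List.mem_toFinset.2 (List.mem_append_right _ (List.mem_singleton_self _)), ?_, ?_⟩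
      · intro p
        simp only [List.toFinset_append, Finset.mem_union, Finset.mem_insert, List.mem_toFinset,
          List.mem_singleton]
        tauto
      · exact (I.mono _ _ (Finset.subset_univ _)).trans (hf ▸ Nat.zero_le _)
    have hcost : I.cost σ.length (fun i => (σ.take i).toFinset) = 0 := by
      refine Finset.sum_eq_zero fun i _ => ?_
      have : (σ.take i).toFinset \ (σ.take (i + 1)).toFinset = ∅ := by
        rw [Finset.sdiff_eq_empty_iff_subset]
        intro p
        simp only [List.mem_toFinset]
        exact fun h => (List.take_subset_take_left σ (Nat.le_succ i)) h
      rw [this, Finset.sum_empty]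
    have h := PagingInstance.expectedCost_le hI one_pos (by simp [hf]) hS
    rw [hcost] at h
    simpa [hf] using h
  · have hmu : (1 : ℝ) ≤ I.mu := by exact_mod_cast I.mu_pos
    have hF : 1 ≤ I.cmax / I.cmin * (I.f Finset.univ : ℝ) := by
      have h1 : 1 ≤ I.cmax / I.cmin := by
        rw [one_le_div I.cmin_pos]
        exact (I.cmin_le (Classical.arbitrary P)).trans (I.le_cmax _)
      have h2 : (1 : ℝ) ≤ I.f Finset.univ := by exact_mod_cast hf
      nlinarith
    obtain ⟨N, hN, hN1, hN2⟩ := PagingInstance.exists_rounds hmu hF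
    refine ⟨I.sampledAlgorithm hI N, fun σ => ?_⟩
    set a := Real.log (1 + (I.mu : ℝ)) with ha
    set b := Real.log (1 + I.cmax / I.cmin * (I.f Finset.univ : ℝ)) with hb
    have ha0 : 0 < a := Real.log_pos (by linarith)
    have hb0 : 0 < b := Real.log_pos (by linarith)
    have hlog : Real.log (1 + ((2 * I.mu : ℕ) : ℝ)) ≤ 2 * a := by
      have h1 : 1 + ((2 * I.mu : ℕ) : ℝ) ≤ (1 + (I.mu : ℝ)) ^ 2 := by push_cast; nlinarith
      have h2 := Real.log_le_log (by positivity) h1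
      rw [Real.log_pow] at h2
      rwa [Nat.cast_ofNat] at h2
    have hρ : 0 < 576 * a ^ 2 * b := by positivity
    rw [← div_le_iff₀' hρ]
    obtain ⟨S₀, hS₀⟩ := I.exists_isSchedule σ
    refine le_csInf ⟨_, S₀, hS₀, rfl⟩ ?_
    rintro x ⟨S, hS, rfl⟩
    rw [div_le_iff₀' hρ]
    have hcost := I.cost_nonneg σ.length S
    have hlog0 : 0 ≤ Real.log (1 + ((2 * I.mu : ℕ) : ℝ)) := Real.log_nonneg (by simp)
    refine (PagingInstance.expectedCost_le hI hN (by exact_mod_cast hN1) hS).trans ?_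
    calc _ ≤ 36 * (a * b) * (8 * (2 * a) * I.cost σ.length S) := by gcongr
      _ = _ := by ring
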